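/- Let $Q=(0,\infty)\times\mathbb R$ and consider the equation $$u_t=\mathcal I[u]\,|u_x|\ \text{ in } Q,\qquad \mathcal I[w](x)=\int_{\mathbb R}\big(w(x+z)-w(x)-z\,w'(x)\big)\frac{dz}{z^2}.\tag{HJ}$$ For $\rho>0$, $B_\rho=(-\rho,\rho)$, $\varphi\in C^2(Q)$ and $u:Q\to\mathbb R$ bounded and measurable, put $$H_\rho[\varphi,u](t,x)=|\varphi_x(t,x)|\left(\int_{B_\rho}\big(\varphi(t,x+z)-\varphi(t,x)-\varphi_x(t,x)z\big)\frac{dz}{z^2}+\int_{B_\rho^c}\big(u(t,x+z)-u(t,x)\big)\frac{dz}{z^2}\right).$$ *Restricted notion.* A bounded upper semicontinuous $u:Q\to\mathbb R$ is a $\rho$-subsolution of (HJ) if, whenever $\varphi\in C^2(Q)$ and $u-\varphi$ has a global maximum over $Q$ at $(\bar t,\bar x)$: $\varphi_t(\bar t,\bar x)\le H_\rho[\varphi,u](\bar t,\bar x)$ if $\varphi_x(\bar t,\bar x)\ne0$; $\varphi_t(\bar t,\bar x)\le 0$ if $\varphi$ has the form $\varphi(t,x)=c|x-\bar x|^4+g(t)$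 on $Q$; and no condition is imposed otherwise. A bounded lower semicontinuous $v:Q\to\mathbb R$ is a $\rho$-supersolution if, whenever $\psi\in C^2(Q)$ and $v-\psi$ has a global minimum over $Q$ at $(\bar t,\bar x)$: $\psi_t(\bar t,\bar x)\ge H_\rho[\psi,v](\bar t,\bar x)$ if $\psi_x(\bar t,\bar x)\neq0$; $\psi_t(\bar t,\bar x)\ge0$ if $\psi(t,x)=c|x-\bar x|^4+g(t)$ on $Q$; and no condition otherwise. *Imbert–Monneau–Rouy notion.* The same, except that the inequality $\varphi_t(\bar t,\bar x)\le H_\rho[\varphi,u](\bar t,\bar x)$ (respectively $\psi_t(\bar t,\bar x)\ge H_\rho[\psi,v](\bar t,\bar x)$) is required for all such test functions $\varphi$ (respectively $\psi$), with no restriction when the space derivative vanishes. In either sense, a bounded function $u:Q\to\mathbb R$ is a viscosity solution (with parameter $\rho$) if its upper semicontinuous envelope $u^*$ is a subsolution and its lower semicontinuous envelope $u_*$ is a supersolution. It has initial datum $u^\circ$ if $u^*(0,x)=u_*(0,x)=u^\circ(x)$ for all $x\in\mathbb R$, where $u^*(0,x)=\limsup_{Q\ni(s,y)\to(0,x)}u(s,y)$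 and $u_*(0,x)=\liminf_{Q\ni(s,y)\to(0,x)}u(s,y)$. **Corollary.** Let $u^\circ:\mathbb R\to\mathbb R$ be bounded and uniformly continuous. Then, for all $\rho,\sigma>0$, a function $u:Q\to\mathbb R$ is a viscosity solution with initial datum $u^\circ$ in the restricted sense with parameter $\rho$ if and only if it is a viscosity solution with initial datum $u^\circ$ in the Imbert–Monneau–Rouy sense with parameter $\sigma$. In particular, (HJ) has a viscosity solution with initial datum $u^\circ$, which is the same for all parameters $\rho>0$ and is unique among functions on $Q$. -/

import Mathlib

open Set Filter Topology MeasureTheory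

namespace HJ

noncomputable section

/-- The open half-plane `Q = (0,∞) × ℝ`, with points written `(t, x)`.
A function `u : Q → ℝ` is represented by a function on `ℝ × ℝ`; all notions below depend only on its
values on `Q`. -/
def Q : Set (ℝ × ℝ) := {p | 0 < p.1}

/-- `u` is bounded on `Q`. -/
def BoundedOnQ (u : ℝ × ℝ → ℝ) : Prop := ∃ M : ℝ, ∀ p ∈ Q, |u p| ≤ M

/-- The upper semicontinuous envelope `u^*` of `u : Q → ℝ`, extended to the boundary `t = 0`. -/
def uscEnv (u : ℝ × ℝ → ℝ) (p : ℝ × ℝ) : ℝ := limsup u (𝓝[Q] p)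

/-- The lower semicontinuous envelope `u_*` of `u : Q → ℝ`, extended to the boundary `t = 0`. -/
def lscEnv (u : ℝ × ℝ → ℝ) (p : ℝ × ℝ) : ℝ := liminf u (𝓝[Q] p)

/-- The time derivative `φ_t` at the point `p = (t, x)`. -/
def dt (φ : ℝ × ℝ → ℝ) (p : ℝ × ℝ) : ℝ := deriv (fun s : ℝ => φ (s, p.2)) p.1

/-- The space derivative `φ_x` at the point `p = (t, x)`. -/
def dx (φ : ℝ × ℝ → ℝ) (p : ℝ × ℝ) : ℝ := deriv (fun y : ℝ => φ (p.1, y)) p.2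

/-- The nonlocal operator `𝓘_ρ[φ, w](x)`: the integral of `(φ(x+z) - φ(x) - φ'(x) z) / z²` over
`B_ρ` plus the integral of `(w(x+z) - w(x)) / z²` over the complement of `B_ρ`. -/
def Irho (ρ : ℝ) (φ w : ℝ → ℝ) (x : ℝ) : ℝ :=
  (∫ z in Metric.ball (0 : ℝ) ρ, (φ (x + z) - φ x - deriv φ x * z) / z ^ 2) +
    ∫ z in (Metric.ball (0 : ℝ) ρ)ᶜ, (w (x + z) - w x) / z ^ 2

/-- The Hamiltonian `H_ρ[φ, u](t, x) = 𝓘_ρ[φ(t,·), u(t,·)](x) |φ_x(t, x)|`. -/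
def Hrho (ρ : ℝ) (φ u : ℝ × ℝ → ℝ) (p : ℝ × ℝ) : ℝ :=
  Irho ρ (fun y => φ (p.1, y)) (fun y => u (p.1, y)) p.2 * |dx φ p|

/-- On `Q`, the function `φ` has the form `φ(t, x) = c |x - x₀|⁴ + g(t)`. -/
def IsQuarticAt (φ : ℝ × ℝ → ℝ) (x₀ : ℝ) : Prop :=
  ∃ (c : ℝ) (g : ℝ → ℝ), ∀ p ∈ Q, φ p = c * |p.2 - x₀| ^ 4 + g p.1

/-- `ρ`-subsolutions with the restricted class of test functions. There is no requirement at a test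
function with `φ_x = 0` at the contact point that is not of the special quartic form. -/
def IsSubsolution (ρ : ℝ) (u : ℝ × ℝ → ℝ) : Prop :=
  UpperSemicontinuousOn u Q ∧ BoundedOnQ u ∧
    ∀ φ : ℝ × ℝ → ℝ, ContDiffOn ℝ 2 φ Q →
      ∀ p ∈ Q, IsMaxOn (fun q => u q - φ q) Q p →
        (dx φ p ≠ 0 → dt φ p ≤ Hrho ρ φ u p) ∧ (IsQuarticAt φ p.2 → dt φ p ≤ 0)

/-- `ρ`-supersolutions with the restricted class of test functions. -/
def IsSupersolution (ρ : ℝ) (v : ℝ × ℝ → ℝ) : Prop :=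
  LowerSemicontinuousOn v Q ∧ BoundedOnQ v ∧
    ∀ ψ : ℝ × ℝ → ℝ, ContDiffOn ℝ 2 ψ Q →
      ∀ p ∈ Q, IsMinOn (fun q => v q - ψ q) Q p →
        (dx ψ p ≠ 0 → Hrho ρ ψ v p ≤ dt ψ p) ∧ (IsQuarticAt ψ p.2 → 0 ≤ dt ψ p)

/-- Viscosity solutions with the restricted class of test functions.
(`u` is bounded on `Q` if and only if `u^*` and `u_*` are finite and bounded on `Q`; stating it
for `u` ensures that the real-valued `limsup` and `liminf` are the genuine ones.) -/
def IsSolution (ρ : ℝ) (u : ℝ × ℝ → ℝ) : Prop :=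
  BoundedOnQ u ∧ IsSubsolution ρ (uscEnv u) ∧ IsSupersolution ρ (lscEnv u)

/-- Subsolutions in the sense of Imbert, Monneau and Rouy: all `C²` test functions are used. -/
def IsIMRSubsolution (ρ : ℝ) (u : ℝ × ℝ → ℝ) : Prop :=
  UpperSemicontinuousOn u Q ∧ BoundedOnQ u ∧
    ∀ φ : ℝ × ℝ → ℝ, ContDiffOn ℝ 2 φ Q →
      ∀ p ∈ Q, IsMaxOn (fun q => u q - φ q) Q p → dt φ p ≤ Hrho ρ φ u p

/-- Supersolutions in the sense of Imbert, Monneau and Rouy. -/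
def IsIMRSupersolution (ρ : ℝ) (v : ℝ × ℝ → ℝ) : Prop :=
  LowerSemicontinuousOn v Q ∧ BoundedOnQ v ∧
    ∀ ψ : ℝ × ℝ → ℝ, ContDiffOn ℝ 2 ψ Q →
      ∀ p ∈ Q, IsMinOn (fun q => v q - ψ q) Q p → Hrho ρ ψ v p ≤ dt ψ p

/-- Viscosity solutions in the sense of Imbert, Monneau and Rouy. -/
def IsIMRSolution (ρ : ℝ) (u : ℝ × ℝ → ℝ) : Prop :=
  BoundedOnQ u ∧ IsIMRSubsolution ρ (uscEnv u) ∧ IsIMRSupersolution ρ (lscEnv u)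

/-- `u : Q → ℝ` has the initial datum `u₀`: both envelopes equal `u₀` at `t = 0`. -/
def HasInitialDatum (u : ℝ × ℝ → ℝ) (u₀ : ℝ → ℝ) : Prop :=
  ∀ x : ℝ, uscEnv u (0, x) = u₀ x ∧ lscEnv u (0, x) = u₀ x

end

end HJ

namespace HJ

/-! ### Calculus of test functions -/

/-! The Hamiltonian is odd (`Hrho_neg`), so a supersolution is the negative of a subsolution. The
argument therefore concerns subsolutions only, applied to the two functions `uscEnv u` and `uscEnv
(-u)`. It rests on three facts.

The radius is irrelevant (`SlopeSub.radius`, `FullSub.radius`). At a contact point the increments of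
the test function dominate those of `u`, so a larger inner ball only weakens the inequality.
Conversely, away from the contact point the test function can be lowered to a `C²` majorant of `u`
that is close to `u` in mean (`exists_contDiff_majorant`), so nothing is lost by the larger ball.

Comparison holds already in the restricted class (`WeakSub.add_nonpos`). In the doubling of
variables a localizing term in `x` would spoil the quartic form of the test functions. An auxiliary
point `z` carries it instead: the penalty is `L(x-z)⁴ + L(y-z)⁴`, plus a time term, a drift and a
term `β√(1+z²)`. In `x` and in `y` the test functions are then exact quartics centred at `z`. They
have nonzero slope unless the contact point is `z`, and there the special quartic condition applies.
The first-order condition in `z` makes the absolute slopes equal up to `β`, and translating `x, y,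
z` together bounds the sum of the nonlocal terms. Quartic barriers (`exists_initial_rate`) keep the
maximum away from time zero.

Perron's method gives a function satisfying the unrestricted inequalities (`exists_full_solution`).
By independence of the radius it is a solution in the Imbert–Monneau–Rouy sense for every radius,
hence also in the restricted sense. By comparison any restricted solution with the same datum equals
it on `Q`, and since envelopes see only values on `Q`, it inherits the stronger property. This gives
the equivalence, existence and uniqueness together. -/

lemma isOpen_Q : IsOpen Q := isOpen_lt continuous_const continuous_fst

lemma mem_Q {p : ℝ × ℝ} : p ∈ Q ↔ 0 < p.1 := Iff.rfl

lemma contDiffAt_of_mem_Q {φ : ℝ × ℝ → ℝ} (hφ : ContDiffOn ℝ 2 φ Q) {p : ℝ × ℝ} (hp : p ∈ Q) :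
    ContDiffAt ℝ 2 φ p :=
  hφ.contDiffAt (isOpen_Q.mem_nhds hp)

lemma hasFDerivAt_of_mem_Q {φ : ℝ × ℝ → ℝ} (hφ : ContDiffOn ℝ 2 φ Q) {p : ℝ × ℝ} (hp : p ∈ Q) :
    HasFDerivAt φ (fderiv ℝ φ p) p :=
  ((contDiffAt_of_mem_Q hφ hp).differentiableAt (by norm_num)).hasFDerivAt

lemma hasDerivAt_space {φ : ℝ × ℝ → ℝ} (hφ : ContDiffOn ℝ 2 φ Q) {p : ℝ × ℝ} (hp : p ∈ Q) :
    HasDerivAt (fun y => φ (p.1, y)) (fderiv ℝ φ p (0, 1)) p.2 :=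
  (hasFDerivAt_of_mem_Q hφ hp).comp_hasDerivAt p.2
    ((hasDerivAt_const p.2 p.1).prodMk (hasDerivAt_id p.2))

lemma hasDerivAt_time {φ : ℝ × ℝ → ℝ} (hφ : ContDiffOn ℝ 2 φ Q) {p : ℝ × ℝ} (hp : p ∈ Q) :
    HasDerivAt (fun s => φ (s, p.2)) (fderiv ℝ φ p (1, 0)) p.1 :=
  (hasFDerivAt_of_mem_Q hφ hp).comp_hasDerivAt p.1
    ((hasDerivAt_id p.1).prodMk (hasDerivAt_const p.1 p.2))

lemma dx_eq_fderiv {φ : ℝ × ℝ → ℝ} (hφ : ContDiffOn ℝ 2 φ Q) {p : ℝ × ℝ} (hp : p ∈ Q) :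
    dx φ p = fderiv ℝ φ p (0, 1) := (hasDerivAt_space hφ hp).deriv

lemma dt_eq_fderiv {φ : ℝ × ℝ → ℝ} (hφ : ContDiffOn ℝ 2 φ Q) {p : ℝ × ℝ} (hp : p ∈ Q) :
    dt φ p = fderiv ℝ φ p (1, 0) := (hasDerivAt_time hφ hp).deriv

lemma contDiffOn_fderiv {φ : ℝ × ℝ → ℝ} (hφ : ContDiffOn ℝ 2 φ Q) (v : ℝ × ℝ) :
    ContDiffOn ℝ 1 (fun q => fderiv ℝ φ q v) Q :=
  (hφ.fderiv_of_isOpen isOpen_Q (by norm_num)).clm_apply contDiffOn_const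

lemma continuousOn_dx {φ : ℝ × ℝ → ℝ} (hφ : ContDiffOn ℝ 2 φ Q) : ContinuousOn (dx φ) Q :=
  (contDiffOn_fderiv hφ (0, 1)).continuousOn.congr fun _ hp => dx_eq_fderiv hφ hp

lemma continuousOn_dt {φ : ℝ × ℝ → ℝ} (hφ : ContDiffOn ℝ 2 φ Q) : ContinuousOn (dt φ) Q :=
  (contDiffOn_fderiv hφ (1, 0)).continuousOn.congr fun _ hp => dt_eq_fderiv hφ hp

lemma continuous_slice {φ : ℝ × ℝ → ℝ} (hφ : ContDiffOn ℝ 2 φ Q) {t : ℝ} (ht : 0 < t) :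
    Continuous fun y => φ (t, y) :=
  hφ.continuousOn.comp_continuous (by fun_prop) fun _ => ht

/-- The derivative of `φ_x` is bounded on a compact convex box inside `Q`. The constant serves all
base points near `p`, which makes it a dominating function when contact points converge. -/
lemma exists_taylor_bound {φ : ℝ × ℝ → ℝ} (hφ : ContDiffOn ℝ 2 φ Q) {p : ℝ × ℝ} (hp : p ∈ Q)
    (r : ℝ) : ∃ C, 0 ≤ C ∧ ∀ᶠ q in 𝓝 p, ∀ z, |z| ≤ r →
      |φ (q.1, q.2 + z) - φ q - dx φ q * z| ≤ C * z ^ 2 := by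
  have hp0 : 0 < p.1 := hp
  set K : Set (ℝ × ℝ) := Metric.closedBall p.1 (p.1 / 2) ×ˢ Metric.closedBall p.2 (r + 1) with hK
  have hKQ : K ⊆ Q := by
    rintro ⟨t, x⟩ ⟨h1, -⟩
    rw [Metric.mem_closedBall, Real.dist_eq, abs_le] at h1
    change 0 < t
    dsimp only at h1
    linarith [h1.1]
  have hKc : IsCompact K := (isCompact_closedBall _ _).prod (isCompact_closedBall _ _)
  have hKconv : Convex ℝ K := (convex_closedBall _ _).prod (convex_closedBall _ _)
  have hG := contDiffOn_fderiv hφ (0, 1)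
  have hG' : ContinuousOn (fderiv ℝ (fun q => fderiv ℝ φ q (0, 1))) K :=
    (hG.continuousOn_fderiv_of_isOpen isOpen_Q le_rfl).mono hKQ
  obtain ⟨C, hC⟩ := hKc.exists_bound_of_continuousOn hG'
  have hlip : ∀ a ∈ K, ∀ b ∈ K,
      ‖fderiv ℝ φ b (0, 1) - fderiv ℝ φ a (0, 1)‖ ≤ C * ‖b - a‖ := fun a ha b hb =>
    hKconv.norm_image_sub_le_of_norm_fderiv_le (𝕜 := ℝ)
      (fun x hx => (hG.contDiffAt (isOpen_Q.mem_nhds (hKQ hx))).differentiableAt (by norm_num))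
      hC ha hb
  have hnear : ∀ᶠ q in 𝓝 p, q.1 ∈ Metric.closedBall p.1 (p.1 / 2) ∧
      q.2 ∈ Metric.closedBall p.2 1 :=
    (continuous_fst.continuousAt.eventually_mem (Metric.closedBall_mem_nhds _ (by linarith))).and
      (continuous_snd.continuousAt.eventually_mem (Metric.closedBall_mem_nhds _ one_pos))
  refine ⟨max C 0, le_max_right _ _, hnear.mono fun q hq z hz => ?_⟩
  have hmem : ∀ s, |s| ≤ |z| → ((q.1, q.2 + s) : ℝ × ℝ) ∈ K := by
    intro s hs
    refine ⟨hq.1, ?_⟩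
    have h2 := hq.2
    rw [Metric.mem_closedBall, Real.dist_eq, abs_le] at h2 ⊢
    have := abs_le.1 (hs.trans hz)
    constructor <;> dsimp only <;> linarith
  have hqK : q ∈ K := by simpa using hmem 0 (by simp)
  have hder : ∀ s ∈ Metric.closedBall (0 : ℝ) |z|,
      HasDerivWithinAt (fun s => φ (q.1, q.2 + s) - φ q - fderiv ℝ φ q (0, 1) * s)
        (fderiv ℝ φ (q.1, q.2 + s) (0, 1) - fderiv ℝ φ q (0, 1))
        (Metric.closedBall (0 : ℝ) |z|) s := by
    intro s hs
    rw [mem_closedBall_zero_iff, Real.norm_eq_abs] at hs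
    have h1 := (hasDerivAt_space hφ (hKQ (hmem s hs)))
    have h2 : HasDerivAt (fun s => φ (q.1, q.2 + s)) (fderiv ℝ φ (q.1, q.2 + s) (0, 1)) s :=
      HasDerivAt.comp_const_add q.2 s h1
    have h3 := (h2.sub_const (φ q)).sub ((hasDerivAt_id s).const_mul (fderiv ℝ φ q (0, 1)))
    rw [mul_one] at h3
    exact h3.hasDerivWithinAt
  have hbd : ∀ s ∈ Metric.closedBall (0 : ℝ) |z|,
      ‖fderiv ℝ φ (q.1, q.2 + s) (0, 1) - fderiv ℝ φ q (0, 1)‖ ≤ max C 0 * |z| := by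
    intro s hs
    rw [mem_closedBall_zero_iff, Real.norm_eq_abs] at hs
    refine (hlip q hqK _ (hmem s hs)).trans ?_
    have : ‖((q.1, q.2 + s) : ℝ × ℝ) - q‖ = |s| := by
      rw [Prod.norm_def]; simp
    rw [this]
    exact mul_le_mul (le_max_left _ _) hs (abs_nonneg _) (le_max_right _ _)
  have key := (convex_closedBall (0 : ℝ) |z|).norm_image_sub_le_of_norm_hasDerivWithin_le hder hbd
    (x := 0) (y := z) (by simp) (by simp)
  rw [dx_eq_fderiv hφ (hKQ hqK)]
  simp only [add_zero, Prod.mk.eta, sub_self, mul_zero, sub_zero, Real.norm_eq_abs] at key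
  calc _ ≤ max C 0 * |z| * |z| := key
    _ = max C 0 * z ^ 2 := by rw [mul_assoc, ← sq, sq_abs]

/-- A function touched from above by a test function has the same first derivatives. -/
lemma dx_eq_dt_eq_of_isMaxOn {φ ψ : ℝ × ℝ → ℝ} (hφ : ContDiffOn ℝ 2 φ Q)
    (hψ : ContDiffOn ℝ 2 ψ Q) {p : ℝ × ℝ} (hp : p ∈ Q)
    (hmax : IsMaxOn (fun q => ψ q - φ q) Q p) : dx φ p = dx ψ p ∧ dt φ p = dt ψ p := by
  have h := (hmax.isLocalMax (isOpen_Q.mem_nhds hp)).hasFDerivAt_eq_zero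
    ((hasFDerivAt_of_mem_Q hψ hp).sub (hasFDerivAt_of_mem_Q hφ hp))
  have h' := sub_eq_zero.1 h
  rw [dx_eq_fderiv hφ hp, dx_eq_fderiv hψ hp, dt_eq_fderiv hφ hp, dt_eq_fderiv hψ hp, h']
  exact ⟨rfl, rfl⟩

/-! ### The nonlocal operator -/

lemma integrableOn_inv_sq {r : ℝ} (hr : 0 < r) :
    IntegrableOn (fun z : ℝ => 1 / z ^ 2) (Metric.ball 0 r)ᶜ := by
  refine Integrable.mono' ((integrable_inv_one_add_sq.const_mul ((1 + r ^ 2) / r ^ 2)).integrableOn)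
    (Measurable.aestronglyMeasurable (by fun_prop)) ?_
  refine (ae_restrict_iff' Metric.isOpen_ball.measurableSet.compl).2 (ae_of_all _ fun z hz => ?_)
  have hz' : r ≤ |z| := by simpa using hz
  have h2 : r ^ 2 ≤ z ^ 2 := by rw [← sq_abs z]; gcongr
  have hr2 : 0 < r ^ 2 := by positivity
  rw [Real.norm_eq_abs, abs_of_nonneg (by positivity), div_mul_eq_mul_div, ← div_eq_mul_inv,
    div_div, div_le_div_iff₀ (by linarith) (by positivity)]
  nlinarith

/-- The mass of the kernel `z⁻²` outside the ball of radius `r`. -/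
noncomputable def tailMass (r : ℝ) : ℝ := ∫ z in (Metric.ball (0 : ℝ) r)ᶜ, 1 / z ^ 2

lemma tailMass_nonneg (r : ℝ) : 0 ≤ tailMass r :=
  integral_nonneg fun z => by positivity

lemma integrableOn_div_sq_of_bound {g : ℝ → ℝ} (hg : Measurable g) {M : ℝ} (hM : ∀ z, |g z| ≤ M)
    {r : ℝ} (hr : 0 < r) : IntegrableOn (fun z => g z / z ^ 2) (Metric.ball (0 : ℝ) r)ᶜ := by
  refine Integrable.mono' ((integrableOn_inv_sq hr).const_mul M)
    (Measurable.aestronglyMeasurable (by fun_prop)) (ae_of_all _ fun z => ?_)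
  rw [Real.norm_eq_abs, abs_div, abs_of_nonneg (sq_nonneg z), mul_one_div]
  exact div_le_div_of_nonneg_right (hM z) (sq_nonneg z)

lemma integral_div_sq_le {g : ℝ → ℝ} {M : ℝ} (hM : ∀ z, |g z| ≤ M) {r : ℝ} (hr : 0 < r) :
    |∫ z in (Metric.ball (0 : ℝ) r)ᶜ, g z / z ^ 2| ≤ M * tailMass r := by
  rw [tailMass, ← integral_const_mul, ← Real.norm_eq_abs]
  refine norm_integral_le_of_norm_le ((integrableOn_inv_sq hr).const_mul M)
    (ae_of_all _ fun z => ?_)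
  rw [Real.norm_eq_abs, abs_div, abs_of_nonneg (sq_nonneg z), mul_one_div]
  exact div_le_div_of_nonneg_right (hM z) (sq_nonneg z)

lemma abs_sub_le_two_mul {w : ℝ → ℝ} {M : ℝ} (hM : ∀ y, |w y| ≤ M) (x y : ℝ) :
    |w y - w x| ≤ 2 * M :=
  (abs_sub _ _).trans (by linarith [hM x, hM y])

lemma integrableOn_outer {w : ℝ → ℝ} (hw : Measurable w) {M : ℝ} (hM : ∀ y, |w y| ≤ M) (x : ℝ)
    {r : ℝ} (hr : 0 < r) :
    IntegrableOn (fun z => (w (x + z) - w x) / z ^ 2) (Metric.ball (0 : ℝ) r)ᶜ :=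
  integrableOn_div_sq_of_bound (g := fun z => w (x + z) - w x) (by fun_prop)
    (fun _ => abs_sub_le_two_mul hM _ _) hr

lemma abs_taylor_div_le {a z C : ℝ} (hC : 0 ≤ C) (h : |a| ≤ C * z ^ 2) : |a / z ^ 2| ≤ C := by
  rcases eq_or_ne z 0 with rfl | hz
  · simpa using hC
  · rwa [abs_div, abs_of_nonneg (sq_nonneg z), div_le_iff₀ (by positivity)]

lemma integrableOn_inner {f : ℝ → ℝ} (hf : Measurable f) {x r C : ℝ} (hC : 0 ≤ C)
    (hb : ∀ z, |z| < r → |f (x + z) - f x - deriv f x * z| ≤ C * z ^ 2) :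
    IntegrableOn (fun z => (f (x + z) - f x - deriv f x * z) / z ^ 2) (Metric.ball (0 : ℝ) r) := by
  have : IsFiniteMeasure (volume.restrict (Metric.ball (0 : ℝ) r)) :=
    ⟨by simpa using measure_ball_lt_top (μ := volume) (x := (0 : ℝ)) (r := r)⟩
  refine Integrable.mono' (integrable_const C) (Measurable.aestronglyMeasurable (by fun_prop)) ?_
  refine (ae_restrict_iff' Metric.isOpen_ball.measurableSet).2 (ae_of_all _ fun z hz => ?_)
  exact abs_taylor_div_le hC (hb z (by simpa using hz))

lemma abs_integral_inner_le {f : ℝ → ℝ} {x r C : ℝ} (hr : 0 ≤ r) (hC : 0 ≤ C)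
    (hb : ∀ z, |z| < r → |f (x + z) - f x - deriv f x * z| ≤ C * z ^ 2) :
    |∫ z in Metric.ball (0 : ℝ) r, (f (x + z) - f x - deriv f x * z) / z ^ 2| ≤ C * (2 * r) := by
  have := norm_setIntegral_le_of_norm_le_const (μ := volume) (s := Metric.ball (0 : ℝ) r)
    (f := fun z => (f (x + z) - f x - deriv f x * z) / z ^ 2) (C := C) measure_ball_lt_top
    (fun z hz => abs_taylor_div_le hC (hb z (by simpa using hz)))
  simpa [Measure.real, Real.volume_ball, ENNReal.toReal_ofReal, hr] using this

lemma integrableOn_inner_slice {φ : ℝ × ℝ → ℝ} (hφ : ContDiffOn ℝ 2 φ Q) {p : ℝ × ℝ} (hp : p ∈ Q)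
    (r : ℝ) : IntegrableOn (fun z => (φ (p.1, p.2 + z) - φ (p.1, p.2) -
      deriv (fun y => φ (p.1, y)) p.2 * z) / z ^ 2) (Metric.ball (0 : ℝ) r) := by
  obtain ⟨C, hC, h⟩ := exists_taylor_bound hφ hp r
  exact integrableOn_inner (f := fun y => φ (p.1, y)) (continuous_slice hφ hp).measurable hC
    fun z hz => h.self_of_nhds z hz.le

lemma Irho_mono {r : ℝ} {φ₁ φ₂ w₁ w₂ : ℝ → ℝ} {x₁ x₂ : ℝ}
    (hi₁ : IntegrableOn (fun z => (φ₁ (x₁ + z) - φ₁ x₁ - deriv φ₁ x₁ * z) / z ^ 2)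
      (Metric.ball (0 : ℝ) r))
    (hi₂ : IntegrableOn (fun z => (φ₂ (x₂ + z) - φ₂ x₂ - deriv φ₂ x₂ * z) / z ^ 2)
      (Metric.ball (0 : ℝ) r))
    (ho₁ : IntegrableOn (fun z => (w₁ (x₁ + z) - w₁ x₁) / z ^ 2) (Metric.ball (0 : ℝ) r)ᶜ)
    (ho₂ : IntegrableOn (fun z => (w₂ (x₂ + z) - w₂ x₂) / z ^ 2) (Metric.ball (0 : ℝ) r)ᶜ)
    (hd : deriv φ₁ x₁ = deriv φ₂ x₂)
    (hφ : ∀ z, |z| < r → φ₁ (x₁ + z) - φ₁ x₁ ≤ φ₂ (x₂ + z) - φ₂ x₂)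
    (hw : ∀ z, r ≤ |z| → w₁ (x₁ + z) - w₁ x₁ ≤ w₂ (x₂ + z) - w₂ x₂) :
    Irho r φ₁ w₁ x₁ ≤ Irho r φ₂ w₂ x₂ := by
  refine add_le_add ?_ ?_
  · refine setIntegral_mono_on hi₁ hi₂ Metric.isOpen_ball.measurableSet fun z hz => ?_
    rw [hd]
    exact div_le_div_of_nonneg_right (by linarith [hφ z (by simpa using hz)]) (sq_nonneg z)
  · refine setIntegral_mono_on ho₁ ho₂ Metric.isOpen_ball.measurableSet.compl fun z hz => ?_
    exact div_le_div_of_nonneg_right (hw z (by simpa using hz)) (sq_nonneg z)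

/-- The integrand is odd and the annulus symmetric. The gradient correction can thus be added or
dropped there, which is why different radii can be compared. -/
lemma integral_annulus_odd (r ρ c : ℝ) :
    ∫ z in Metric.ball (0 : ℝ) ρ \ Metric.ball (0 : ℝ) r, c * z / z ^ 2 = 0 := by
  have hm : MeasurableSet (Metric.ball (0 : ℝ) ρ \ Metric.ball (0 : ℝ) r) :=
    Metric.isOpen_ball.measurableSet.diff Metric.isOpen_ball.measurableSet
  rw [← integral_indicator hm]
  have h := integral_neg_eq_self
    ((Metric.ball (0 : ℝ) ρ \ Metric.ball (0 : ℝ) r).indicator fun z => c * z / z ^ 2) volume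
  have h2 : ∀ z, (Metric.ball (0 : ℝ) ρ \ Metric.ball (0 : ℝ) r).indicator
      (fun z => c * z / z ^ 2) (-z) = -(Metric.ball (0 : ℝ) ρ \ Metric.ball (0 : ℝ) r).indicator
      (fun z => c * z / z ^ 2) z := by
    intro z
    have hz : -z ∈ Metric.ball (0 : ℝ) ρ \ Metric.ball (0 : ℝ) r ↔
        z ∈ Metric.ball (0 : ℝ) ρ \ Metric.ball (0 : ℝ) r := by simp
    by_cases hz' : z ∈ Metric.ball (0 : ℝ) ρ \ Metric.ball (0 : ℝ) r
    · rw [indicator_of_mem hz', indicator_of_mem (hz.2 hz')]; ring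
    · rw [indicator_of_notMem hz', indicator_of_notMem (fun h => hz' (hz.1 h))]; ring
  simp_rw [h2, integral_neg] at h
  linarith

/-- Enlarging the inner ball amounts to replacing `w` by the test function in the annulus. -/
lemma Irho_eq_of_le {r ρ : ℝ} (hr : 0 < r) (hrρ : r ≤ ρ) {φ w : ℝ → ℝ}
    (hw : Measurable w) {M : ℝ} (hM : ∀ y, |w y| ≤ M) {x : ℝ}
    (hi : IntegrableOn (fun z => (φ (x + z) - φ x - deriv φ x * z) / z ^ 2)
      (Metric.ball (0 : ℝ) ρ)) :
    IntegrableOn (fun z => (if |z| < ρ then φ (x + z) - φ x else w (x + z) - w x) / z ^ 2)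
      (Metric.ball (0 : ℝ) r)ᶜ ∧
    Irho ρ φ w x = (∫ z in Metric.ball (0 : ℝ) r, (φ (x + z) - φ x - deriv φ x * z) / z ^ 2) +
      ∫ z in (Metric.ball (0 : ℝ) r)ᶜ,
        (if |z| < ρ then φ (x + z) - φ x else w (x + z) - w x) / z ^ 2 := by
  have hmb : ∀ s, MeasurableSet (Metric.ball (0 : ℝ) s) :=
    fun s => Metric.isOpen_ball.measurableSet
  have hsub : Metric.ball (0 : ℝ) r ⊆ Metric.ball 0 ρ := Metric.ball_subset_ball hrρ
  set A := Metric.ball (0 : ℝ) ρ \ Metric.ball (0 : ℝ) r with hA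
  have hAm : MeasurableSet A := (hmb _).diff (hmb _)
  have hAfin : IsFiniteMeasure (volume.restrict A) :=
    ⟨by simpa using (measure_mono sdiff_subset).trans_lt (measure_ball_lt_top (μ := volume) (x := (0 : ℝ)))⟩
  have hU : Metric.ball (0 : ℝ) ρ = Metric.ball (0 : ℝ) r ∪ A := (union_sdiff_cancel hsub).symm
  have hUc : (Metric.ball (0 : ℝ) r)ᶜ = A ∪ (Metric.ball (0 : ℝ) ρ)ᶜ := by
    ext z
    simp only [hA, mem_compl_iff, mem_union, Set.mem_sdiff]
    constructor
    · intro h; by_cases h' : z ∈ Metric.ball (0 : ℝ) ρ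
      · exact Or.inl ⟨h', h⟩
      · exact Or.inr h'
    · rintro (h | h)
      · exact h.2
      · exact fun h' => h (hsub h')
  have hodd : IntegrableOn (fun z : ℝ => deriv φ x * z / z ^ 2) A := by
    refine Integrable.mono' (integrable_const (|deriv φ x| / r))
      (Measurable.aestronglyMeasurable (by fun_prop)) ?_
    refine (ae_restrict_iff' hAm).2 (ae_of_all _ fun z hz => ?_)
    have hz' : r ≤ |z| := by simpa using hz.2
    have hz0 : 0 < |z| := hr.trans_le hz'
    rw [Real.norm_eq_abs, abs_div, abs_mul, abs_of_nonneg (sq_nonneg z), ← sq_abs z, sq,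
      mul_div_mul_right _ _ hz0.ne']
    gcongr
  have hAi : IntegrableOn (fun z => (φ (x + z) - φ x) / z ^ 2) A := by
    have := (hi.mono_set sdiff_subset).add hodd
    refine this.congr (ae_of_all _ fun z => ?_)
    simp only [Pi.add_apply]; ring
  have e1 : ∫ z in A, (φ (x + z) - φ x - deriv φ x * z) / z ^ 2 =
      ∫ z in A, (φ (x + z) - φ x) / z ^ 2 := by
    have : ∀ z, (φ (x + z) - φ x - deriv φ x * z) / z ^ 2 =
      (φ (x + z) - φ x) / z ^ 2 - deriv φ x * z / z ^ 2 := fun z => by ring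
    simp_rw [this]
    rw [integral_sub hAi hodd, integral_annulus_odd, sub_zero]
  have c1 : EqOn (fun z => (if |z| < ρ then φ (x + z) - φ x else w (x + z) - w x) / z ^ 2)
      (fun z => (φ (x + z) - φ x) / z ^ 2) A := fun z hz => by
    have : |z| < ρ := by simpa using hz.1
    simp only [this, if_true]
  have c2 : EqOn (fun z => (if |z| < ρ then φ (x + z) - φ x else w (x + z) - w x) / z ^ 2)
      (fun z => (w (x + z) - w x) / z ^ 2) (Metric.ball (0 : ℝ) ρ)ᶜ := fun z hz => by
    have : ¬ |z| < ρ := by simpa using hz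
    simp only [this, if_false]
  have ho := integrableOn_outer hw hM x (hr.trans_le hrρ)
  refine ⟨hUc ▸ (hAi.congr_fun c1.symm hAm).union
    (ho.congr_fun c2.symm (hmb _).compl), ?_⟩
  rw [Irho, hUc, hU, setIntegral_union disjoint_sdiff_self_right hAm
    (hi.mono_set hsub) (hi.mono_set sdiff_subset), e1, ← hU,
    setIntegral_union (disjoint_compl_right.mono_left sdiff_subset) (hmb _).compl
      (hAi.congr_fun c1.symm hAm) (ho.congr_fun c2.symm (hmb _).compl),
    setIntegral_congr_fun hAm c1, setIntegral_congr_fun (hmb _).compl c2, add_assoc]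

/-! ### Independence of the radius -/

open scoped Manifold ContDiff

/-- The subsolution inequality at test functions with nonzero slope at the contact point. -/
def SlopeSub (ρ : ℝ) (u : ℝ × ℝ → ℝ) : Prop :=
  ∀ φ : ℝ × ℝ → ℝ, ContDiffOn ℝ 2 φ Q → ∀ p ∈ Q, IsMaxOn (fun q => u q - φ q) Q p →
    dx φ p ≠ 0 → dt φ p ≤ Hrho ρ φ u p

lemma measurable_slice {u : ℝ × ℝ → ℝ} (hu : UpperSemicontinuousOn u Q) {t : ℝ} (ht : 0 < t) :
    Measurable fun y => u (t, y) :=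
  UpperSemicontinuous.measurable <| upperSemicontinuousOn_univ_iff.1 <|
    hu.comp (g := fun y : ℝ => (t, y)) (t := univ) (by fun_prop) fun _ _ => ht

/-- By `Irho_eq_of_le`, enlarging the ball replaces increments of `u` in the annulus by increments
of `φ`, and these are larger because `u - φ` is maximal at `p`. -/
lemma Irho_le_Irho_of_isMaxOn {u φ : ℝ × ℝ → ℝ} (hu : UpperSemicontinuousOn u Q)
    (hb : BoundedOnQ u) (hφ : ContDiffOn ℝ 2 φ Q) {p : ℝ × ℝ} (hp : p ∈ Q)
    (hmax : IsMaxOn (fun q => u q - φ q) Q p) {r ρ : ℝ} (hr : 0 < r) (hrρ : r ≤ ρ) :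
    Irho r (fun y => φ (p.1, y)) (fun y => u (p.1, y)) p.2 ≤
      Irho ρ (fun y => φ (p.1, y)) (fun y => u (p.1, y)) p.2 := by
  obtain ⟨M, hM⟩ := hb
  have hM' : ∀ y, |u (p.1, y)| ≤ M := fun y => hM _ hp
  obtain ⟨h1, h2⟩ := Irho_eq_of_le (φ := fun y => φ (p.1, y)) (w := fun y => u (p.1, y))
    (x := p.2) hr hrρ (measurable_slice hu hp) hM'
    (integrableOn_inner_slice hφ hp ρ)
  rw [h2, Irho]
  refine add_le_add le_rfl (setIntegral_mono_on (integrableOn_outer (measurable_slice hu hp) hM'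
    p.2 hr) h1 Metric.isOpen_ball.measurableSet.compl fun z _ => ?_)
  refine div_le_div_of_nonneg_right ?_ (sq_nonneg z)
  split_ifs
  · have := hmax (show ((p.1, p.2 + z) : ℝ × ℝ) ∈ Q from hp)
    simp only [mem_ofPred_eq] at this
    simp only [Prod.mk.eta]
    linarith
  · rfl

lemma SlopeSub.of_le {u : ℝ × ℝ → ℝ} {r ρ : ℝ} (h : SlopeSub r u)
    (hu : UpperSemicontinuousOn u Q) (hb : BoundedOnQ u) (hr : 0 < r) (hrρ : r ≤ ρ) :
    SlopeSub ρ u := fun φ hφ p hp hmax hd =>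
  (h φ hφ p hp hmax hd).trans <| mul_le_mul_of_nonneg_right
    (Irho_le_Irho_of_isMaxOn hu hb hφ hp hmax hr hrρ) (abs_nonneg _)

/-- A smooth majorant of an upper semicontinuous function `u`, equal to a given test function `φ`
near the contact point `p` and bounded by a given lower semicontinuous function on the time slice
away from `p`. -/
lemma exists_contDiff_majorant {u φ : ℝ × ℝ → ℝ} (hu : UpperSemicontinuousOn u Q)
    (hb : BoundedOnQ u) (hφ : ContDiffOn ℝ 2 φ Q) (hle : ∀ q ∈ Q, u q ≤ φ q)
    {p : ℝ × ℝ} (hp : p ∈ Q) {r : ℝ} (hr : 0 < r) {g : ℝ → EReal} (hg : LowerSemicontinuous g)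
    (hug : ∀ z, (u (p.1, p.2 + z) : EReal) < g z) :
    ∃ Φ : ℝ × ℝ → ℝ, ContDiff ℝ 2 Φ ∧ (∀ q ∈ Q, u q ≤ Φ q) ∧ Φ =ᶠ[𝓝 p] φ ∧
      (∀ z, |z| ≤ r / 2 → Φ (p.1, p.2 + z) = φ (p.1, p.2 + z)) ∧
      (∀ z, r ≤ |z| → (Φ (p.1, p.2 + z) : EReal) ≤ g z) ∧
      (∀ z, |z| < r → (Φ (p.1, p.2 + z) : EReal) ≤ max (φ (p.1, p.2 + z) : EReal) (g z)) := by
  obtain ⟨M, hM⟩ := hb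
  have hp0 : 0 < p.1 := hp
  set N₁ : Set (ℝ × ℝ) := {q | |q.1 - p.1| ≤ p.1 / 2 ∧ |q.2 - p.2| ≤ r / 2} with hN₁
  set N₂ : Set (ℝ × ℝ) := {q | |q.1 - p.1| < p.1 ∧ |q.2 - p.2| < r} with hN₂
  have hN₁c : IsClosed N₁ := 
    (isClosed_le (f := fun q : ℝ × ℝ => |q.1 - p.1|) (by fun_prop) continuous_const).inter
    (isClosed_le (f := fun q : ℝ × ℝ => |q.2 - p.2|) (by fun_prop) continuous_const)
  have hN₂o : IsOpen N₂ := 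
    (isOpen_lt (f := fun q : ℝ × ℝ => |q.1 - p.1|) (by fun_prop) continuous_const).inter
    (isOpen_lt (f := fun q : ℝ × ℝ => |q.2 - p.2|) (by fun_prop) continuous_const)
  have h12 : N₁ ⊆ N₂ := fun q hq => ⟨by linarith [hq.1], by linarith [hq.2]⟩
  have h2Q : N₂ ⊆ Q := fun q hq => by
    have := (abs_lt.1 hq.1).1
    change 0 < q.1
    linarith
  -- All requirements on the value of the majorant at `q` cut out an interval. A partition of unity
  -- can therefore glue local solutions: `φ` itself on `N₂`, and constants elsewhere.
  set t : ℝ × ℝ → Set ℝ := fun q => {y | (q ∈ Q → u q ≤ y) ∧ (q ∈ N₁ → y = φ q) ∧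
    (q.1 = p.1 → r ≤ |q.2 - p.2| → (y : EReal) ≤ g (q.2 - p.2)) ∧
    (q.1 = p.1 → |q.2 - p.2| < r → (y : EReal) ≤ max (φ q : EReal) (g (q.2 - p.2)))} with ht
  have hconv : ∀ q, Convex ℝ (t q) := by
    intro q
    refine OrdConnected.convex ⟨fun a ha b hb y hy => ⟨fun h => (ha.1 h).trans hy.1, fun h => ?_,
      fun h h' => ?_, fun h h' => ?_⟩⟩
    · exact le_antisymm (hy.2.trans (hb.2.1 h).le) ((ha.2.1 h).ge.trans hy.1)
    · exact (EReal.coe_le_coe_iff.2 hy.2).trans (hb.2.2.1 h h')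
    · exact (EReal.coe_le_coe_iff.2 hy.2).trans (hb.2.2.2 h h')
  have hloc : ∀ q : ℝ × ℝ, ∃ U ∈ 𝓝 q, ∃ G : ℝ × ℝ → ℝ,
      ContMDiffOn 𝓘(ℝ, ℝ × ℝ) 𝓘(ℝ, ℝ) 2 G U ∧ ∀ y ∈ U, G y ∈ t y := by
    intro q
    by_cases hq : q ∈ N₂
    · refine ⟨N₂, hN₂o.mem_nhds hq, φ, (hφ.mono h2Q).contMDiffOn, fun y hy =>
        ⟨fun h => hle y h, fun _ => rfl, fun _ h => absurd hy.2 (not_lt.2 h), fun _ _ =>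
          le_max_left _ _⟩⟩
    · have hN : ∀ᶠ y in 𝓝 q, y ∉ N₁ := hN₁c.isOpen_compl.mem_nhds fun h => hq (h12 h)
      suffices h : ∃ c : ℝ, ∀ᶠ y in 𝓝 q, (y ∈ Q → u y ≤ c) ∧
          (y.1 = p.1 → (c : EReal) ≤ g (y.2 - p.2)) by
        obtain ⟨c, hc⟩ := h
        refine ⟨_, hN.and hc, fun _ => c, contMDiffOn_const, fun y hy =>
          ⟨hy.2.1, fun h => absurd h hy.1, fun h _ => hy.2.2 h, fun h _ =>
            (hy.2.2 h).trans (le_max_right _ _)⟩⟩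
      -- On the time slice of `p`, a constant strictly between `u` and `g` remains admissible nearby
      -- by the two semicontinuities. Off the slice `g` plays no role and the bound `M` is enough.
      by_cases hqt : q.1 = p.1
      · have hqQ : q ∈ Q := by rw [mem_Q, hqt]; exact hp
        have h1 := hug (q.2 - p.2)
        rw [add_sub_cancel, ← hqt, Prod.mk.eta] at h1
        obtain ⟨c, hc1, hc2⟩ := EReal.lt_iff_exists_real_btwn.1 h1
        refine ⟨c, ?_⟩
        have e1 := hu q hqQ c (EReal.coe_lt_coe_iff.1 hc1)
        rw [isOpen_Q.nhdsWithin_eq hqQ] at e1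
        have e2 : ∀ᶠ y : ℝ × ℝ in 𝓝 q, (c : EReal) < g (y.2 - p.2) :=
          ((by fun_prop : Continuous fun y : ℝ × ℝ => y.2 - p.2).tendsto q).eventually
            (hg (q.2 - p.2) c hc2)
        filter_upwards [e1, e2] with y h1 h2 using ⟨fun _ => h1.le, fun _ => h2.le⟩
      · refine ⟨M, ?_⟩
        have : ∀ᶠ y : ℝ × ℝ in 𝓝 q, y.1 ≠ p.1 :=
          continuous_fst.continuousAt.eventually_ne hqt
        filter_upwards [this] with y hy using
          ⟨fun h => (le_abs_self _).trans (hM y h), fun h => absurd h hy⟩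
  obtain ⟨Φ, hΦ⟩ := exists_contMDiffMap_forall_mem_convex_of_local (n := 2)
    𝓘(ℝ, ℝ × ℝ) (t := t) hconv hloc
  refine ⟨Φ, Φ.contMDiff.contDiff, fun q hq => (hΦ q).1 hq, ?_, fun z hz => ?_, fun z hz => ?_,
    fun z hz => ?_⟩
  · have h1 : ∀ᶠ q : ℝ × ℝ in 𝓝 p, |q.1 - p.1| < p.1 / 2 :=
      (by fun_prop : Continuous fun q : ℝ × ℝ => |q.1 - p.1|).continuousAt.eventually_lt
        continuousAt_const (by simpa using hp0)
    have h2 : ∀ᶠ q : ℝ × ℝ in 𝓝 p, |q.2 - p.2| < r / 2 :=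
      (by fun_prop : Continuous fun q : ℝ × ℝ => |q.2 - p.2|).continuousAt.eventually_lt
        continuousAt_const (by simpa using hr)
    filter_upwards [h1, h2] with q a b using (hΦ q).2.1 ⟨a.le, b.le⟩
  · exact (hΦ _).2.1 ⟨by simp only [sub_self, abs_zero]; linarith, by simpa using hz⟩
  · simpa using (hΦ (p.1, p.2 + z)).2.2.1 rfl (by simpa using hz)
  · simpa using (hΦ (p.1, p.2 + z)).2.2.2 rfl (by simpa using hz)

/-- The subsolution inequality for one radius implies it for every smaller radius. -/
lemma SlopeSub.of_ge {u : ℝ × ℝ → ℝ} {r ρ : ℝ} (h : SlopeSub ρ u)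
    (hu : UpperSemicontinuousOn u Q) (hb : BoundedOnQ u) (hr : 0 < r) (hrρ : r ≤ ρ) :
    SlopeSub r u := by
  intro φ₀ hφ₀ p hp hmax₀ hd₀
  obtain ⟨M, hM⟩ := hb
  set φ : ℝ × ℝ → ℝ := fun q => φ₀ q + (u p - φ₀ p) with hφdef
  have hφ : ContDiffOn ℝ 2 φ Q := hφ₀.add contDiffOn_const
  have hle : ∀ q ∈ Q, u q ≤ φ q := fun q hq => by
    have := hmax₀ hq
    simp only [mem_ofPred_eq] at this
    simp only [hφdef]
    linarith
  have hdx : dx φ p = dx φ₀ p := by simp [dx, hφdef]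
  have hdt : dt φ p = dt φ₀ p := by simp [dt, hφdef]
  have hφp : φ p = u p := by simp [hφdef]
  have hI : Irho r (fun y => φ (p.1, y)) (fun y => u (p.1, y)) p.2 =
      Irho r (fun y => φ₀ (p.1, y)) (fun y => u (p.1, y)) p.2 := by
    simp only [Irho, hφdef, add_sub_add_right_eq_sub, deriv_add_const]
  have hd : 0 < |dx φ₀ p| := abs_pos.2 hd₀
  rw [Hrho, ← hI]
  rw [← div_le_iff₀ hd]
  refine le_of_forall_pos_le_add fun ε hε => ?_
  rw [div_le_iff₀ hd]
  have hM' : ∀ y, |u (p.1, y)| ≤ M := fun y => hM _ hp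
  have hmeas : Measurable fun y => u (p.1, y) := measurable_slice hu hp
  have hmb : ∀ s, MeasurableSet (Metric.ball (0 : ℝ) s) :=
    fun s => Metric.isOpen_ball.measurableSet
  have : IsFiniteMeasure (volume.restrict (Metric.ball (0 : ℝ) ρ)) :=
    ⟨by simpa using measure_ball_lt_top (μ := volume) (x := (0 : ℝ)) (r := ρ)⟩
  have hf : Integrable (fun z => u (p.1, p.2 + z)) (volume.restrict (Metric.ball (0 : ℝ) ρ)) :=
    Integrable.mono' (integrable_const M)
      (hmeas.comp (measurable_const_add p.2)).aestronglyMeasurable (ae_of_all _ fun z => hM' _)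
  -- The Vitali–Carathéodory theorem gives `g > u` lower semicontinuous and close to `u` in mean.
  -- The kernel is at most `4 / r²` where `|z| ≥ r / 2`, so this tolerance costs at most `ε` in the
  -- nonlocal term.
  obtain ⟨g, hfg, hglsc, hgi, hgt, hgint⟩ := exists_lt_lowerSemicontinuous_integral_lt _ hf
    (ε := ε * (r ^ 2 / 4)) (by positivity)
  obtain ⟨Φ, hΦ, hΦu, hΦp, hΦ1, hΦ2, hΦ3⟩ :=
    exists_contDiff_majorant hu ⟨M, hM⟩ hφ hle hp hr hglsc hfg
  have hΦQ : ContDiffOn ℝ 2 Φ Q := hΦ.contDiffOn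
  have hΦpp : Φ p = u p := by rw [hΦp.self_of_nhds, hφp]
  have hfd : fderiv ℝ Φ p = fderiv ℝ φ p := hΦp.fderiv_eq
  have hΦdx : dx Φ p = dx φ p := by rw [dx_eq_fderiv hΦQ hp, dx_eq_fderiv hφ hp, hfd]
  have hΦdt : dt Φ p = dt φ p := by rw [dt_eq_fderiv hΦQ hp, dt_eq_fderiv hφ hp, hfd]
  have hΦmax : IsMaxOn (fun q => u q - Φ q) Q p := fun q hq => by
    simp only [mem_ofPred_eq, hΦpp, sub_self]
    linarith [hΦu q hq]
  have hmain := h Φ hΦQ p hp hΦmax (by rwa [hΦdx, hdx])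
  rw [hΦdt, hdt, Hrho, hΦdx, hdx] at hmain
  refine hmain.trans (mul_le_mul_of_nonneg_right ?_ (abs_nonneg _))
  obtain ⟨hi1, hi2⟩ := Irho_eq_of_le (φ := fun y => Φ (p.1, y)) (w := fun y => u (p.1, y))
    (x := p.2) hr hrρ hmeas hM' (integrableOn_inner_slice hΦQ hp ρ)
  -- A single function dominates the error both in the shell `r/2 < |z| < r` and in the annulus `r ≤
  -- |z| < ρ`. Since `g` may be `⊤` on a null set, where `toReal` is `0`, its sign is controlled
  -- only almost everywhere.
  set K : ℝ → ℝ := (Metric.ball (0 : ℝ) ρ).indicator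
    fun z => (4 / r ^ 2) * ((g z).toReal - u (p.1, p.2 + z)) with hK
  have hKi : Integrable K :=
    (integrable_indicator_iff (hmb ρ)).2 ((hgi.sub hf).const_mul (4 / r ^ 2))
  have hKint : ∫ z, K z ≤ ε := by
    rw [hK, integral_indicator (hmb ρ), integral_const_mul, integral_sub hgi hf]
    calc _ ≤ 4 / r ^ 2 * (ε * (r ^ 2 / 4)) := by gcongr; linarith
      _ = ε := by field_simp
  have hgt' : ∀ᵐ z, z ∈ Metric.ball (0 : ℝ) ρ → g z < ⊤ := (ae_restrict_iff' (hmb ρ)).1 hgt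
  have hgreal : ∀ z, g z < ⊤ → ((g z).toReal : EReal) = g z := fun z hz =>
    EReal.coe_toReal hz.ne (ne_bot_of_gt (hfg z))
  have hKnn : ∀ᵐ z, 0 ≤ K z := by
    filter_upwards [hgt'] with z hz
    refine indicator_apply_nonneg fun hzρ => ?_
    have h1 := hfg z
    rw [← hgreal z (hz hzρ), EReal.coe_lt_coe_iff] at h1
    have : 0 ≤ 4 / r ^ 2 := by positivity
    exact mul_nonneg this (by linarith)
  have hdiv : ∀ a z : ℝ, 0 ≤ a → r / 2 ≤ |z| → a / z ^ 2 ≤ 4 / r ^ 2 * a := by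
    intro a z ha hz
    have hz2 : (r / 2) ^ 2 ≤ z ^ 2 := by rw [← sq_abs z]; gcongr
    have : 1 / z ^ 2 ≤ 4 / r ^ 2 := by
      rw [div_le_div_iff₀ (by nlinarith [pow_pos hr 2]) (by positivity)]; nlinarith
    calc a / z ^ 2 = 1 / z ^ 2 * a := by ring
      _ ≤ _ := by gcongr
  have hderiv : deriv (fun y => Φ (p.1, y)) p.2 = deriv (fun y => φ (p.1, y)) p.2 := hΦdx
  rw [hi2, Irho]
  have hinner : ∫ z in Metric.ball (0 : ℝ) r, (Φ (p.1, p.2 + z) - Φ (p.1, p.2) -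
      deriv (fun y => Φ (p.1, y)) p.2 * z) / z ^ 2 ≤
      (∫ z in Metric.ball (0 : ℝ) r, (φ (p.1, p.2 + z) - φ (p.1, p.2) -
      deriv (fun y => φ (p.1, y)) p.2 * z) / z ^ 2) + ∫ z in Metric.ball (0 : ℝ) r, K z := by
    rw [← integral_add (integrableOn_inner_slice hφ hp r) hKi.integrableOn]
    refine integral_mono_ae (integrableOn_inner_slice hΦQ hp r)
      ((integrableOn_inner_slice hφ hp r).add hKi.integrableOn) ?_
    refine (ae_restrict_iff' (hmb r)).2 ?_
    filter_upwards [hgt', hKnn] with z hz hKz hzr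
    have hzρ : z ∈ Metric.ball (0 : ℝ) ρ := Metric.ball_subset_ball hrρ hzr
    have hzr' : |z| < r := by simpa using hzr
    have hgz := hgreal z (hz hzρ)
    simp only [Prod.mk.eta]
    rw [hderiv, hΦpp, hφp]
    rcases le_or_gt |z| (r / 2) with hz2 | hz2
    · rw [hΦ1 z hz2]; linarith
    · have h3 := hΦ3 z hzr'
      rw [← hgz] at h3
      have h4 : Φ (p.1, p.2 + z) ≤ φ (p.1, p.2 + z) + ((g z).toReal - u (p.1, p.2 + z)) := by
        have h5 := hle (p.1, p.2 + z) hp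
        have h6 := hfg z
        rw [← hgz, EReal.coe_lt_coe_iff] at h6
        rcases le_max_iff.1 h3 with h3 | h3 <;> rw [EReal.coe_le_coe_iff] at h3 <;> linarith
      have hpos : 0 ≤ (g z).toReal - u (p.1, p.2 + z) := by
        have h6 := hfg z
        rw [← hgz, EReal.coe_lt_coe_iff] at h6
        linarith
      have h7 := hdiv _ z hpos hz2.le
      rw [hK, indicator_of_mem hzρ]
      have h8 : (Φ (p.1, p.2 + z) - u p - deriv (fun y => φ (p.1, y)) p.2 * z) / z ^ 2 ≤
          (φ (p.1, p.2 + z) + ((g z).toReal - u (p.1, p.2 + z)) - u p -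
            deriv (fun y => φ (p.1, y)) p.2 * z) / z ^ 2 :=
        div_le_div_of_nonneg_right (by linarith) (sq_nonneg z)
      refine h8.trans (le_trans (le_of_eq ?_) (add_le_add le_rfl h7))
      ring
  have houter : ∫ z in (Metric.ball (0 : ℝ) r)ᶜ, (if |z| < ρ then
      Φ (p.1, p.2 + z) - Φ (p.1, p.2) else u (p.1, p.2 + z) - u (p.1, p.2)) / z ^ 2 ≤
      (∫ z in (Metric.ball (0 : ℝ) r)ᶜ, (u (p.1, p.2 + z) - u (p.1, p.2)) / z ^ 2) +
        ∫ z in (Metric.ball (0 : ℝ) r)ᶜ, K z := by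
    have ho := integrableOn_outer hmeas hM' p.2 hr
    rw [← integral_add ho hKi.integrableOn]
    refine integral_mono_ae hi1 (ho.add hKi.integrableOn) ?_
    refine (ae_restrict_iff' (hmb r).compl).2 ?_
    filter_upwards [hgt', hKnn] with z hz hKz hzr
    have hzr' : r ≤ |z| := by simpa using hzr
    simp only [Prod.mk.eta, hΦpp]
    split_ifs with hzρ
    · have hzρ' : z ∈ Metric.ball (0 : ℝ) ρ := by simpa using hzρ
      have hgz := hgreal z (hz hzρ')
      have h3 := hΦ2 z hzr'
      rw [← hgz, EReal.coe_le_coe_iff] at h3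
      have hpos : 0 ≤ (g z).toReal - u (p.1, p.2 + z) := by
        have h6 := hfg z
        rw [← hgz, EReal.coe_lt_coe_iff] at h6
        linarith
      have h7 := hdiv _ z hpos (by linarith)
      rw [hK, indicator_of_mem hzρ']
      have h8 : (Φ (p.1, p.2 + z) - u p) / z ^ 2 ≤ ((g z).toReal - u p) / z ^ 2 :=
        div_le_div_of_nonneg_right (by linarith) (sq_nonneg z)
      refine h8.trans (le_trans (le_of_eq ?_) (add_le_add le_rfl h7))
      ring
    · linarith
  have hsum := integral_add_compl (hmb r) hKi
  linarith

lemma SlopeSub.radius {u : ℝ × ℝ → ℝ} {r ρ : ℝ} (h : SlopeSub ρ u)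
    (hu : UpperSemicontinuousOn u Q) (hb : BoundedOnQ u) (hr : 0 < r) (hρ : 0 < ρ) :
    SlopeSub r u := by
  rcases le_total r ρ with h' | h'
  · exact h.of_ge hu hb hr h'
  · exact h.of_le hu hb hρ h'

/-! ### Restricted subsolutions and quartic barriers -/

/-- The closed half-plane. -/
def Qbar : Set (ℝ × ℝ) := {p | 0 ≤ p.1}

lemma mem_Qbar {p : ℝ × ℝ} : p ∈ Qbar ↔ 0 ≤ p.1 := Iff.rfl

lemma Q_subset_Qbar : Q ⊆ Qbar := fun _ hp => mem_Qbar.2 (le_of_lt hp)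

/-- The subsolution inequality at the special quartic test functions. -/
def QuarticSub (u : ℝ × ℝ → ℝ) : Prop :=
  ∀ φ : ℝ × ℝ → ℝ, ContDiffOn ℝ 2 φ Q → ∀ p ∈ Q, IsMaxOn (fun q => u q - φ q) Q p →
    IsQuarticAt φ p.2 → dt φ p ≤ 0

/-- Restricted subsolutions that are bounded and upper semicontinuous up to time zero. -/
structure WeakSub (ρ M : ℝ) (u : ℝ × ℝ → ℝ) : Prop where
  usc : UpperSemicontinuousOn u Qbar
  bound : ∀ p ∈ Qbar, |u p| ≤ M
  slope : SlopeSub ρ u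
  quartic : QuarticSub u

lemma le_of_isMaxOn {u φ : ℝ × ℝ → ℝ} {s : Set (ℝ × ℝ)} {p q : ℝ × ℝ}
    (h : IsMaxOn (fun q => u q - φ q) s p) (hq : q ∈ s) : u q - φ q ≤ u p - φ p := h hq

namespace WeakSub

variable {ρ M : ℝ} {u : ℝ × ℝ → ℝ}

lemma usc_Q (h : WeakSub ρ M u) : UpperSemicontinuousOn u Q := h.usc.mono Q_subset_Qbar

lemma bdd (h : WeakSub ρ M u) : BoundedOnQ u := ⟨M, fun p hp => h.bound p (Q_subset_Qbar hp)⟩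

end WeakSub

/-- The test function `K (x - a)⁴ + g(t)`. -/
def quarticTest (K a : ℝ) (g : ℝ → ℝ) (q : ℝ × ℝ) : ℝ := K * (q.2 - a) ^ 4 + g q.1

lemma contDiff_quarticTest (K a : ℝ) {g : ℝ → ℝ} (hg : ContDiff ℝ 2 g) :
    ContDiff ℝ 2 (quarticTest K a g) := by
  unfold quarticTest
  fun_prop

lemma hasDerivAt_quartic (K a c x : ℝ) :
    HasDerivAt (fun y => K * (y - a) ^ 4 + c) (4 * K * (x - a) ^ 3) x := by
  have h := ((((hasDerivAt_id x).sub_const a).pow 4).const_mul K).add_const c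
  refine h.congr_deriv ?_
  simp only [id]
  push_cast
  ring

lemma dx_quarticTest (K a : ℝ) (g : ℝ → ℝ) (p : ℝ × ℝ) :
    dx (quarticTest K a g) p = 4 * K * (p.2 - a) ^ 3 :=
  (hasDerivAt_quartic K a (g p.1) p.2).deriv

lemma dt_quarticTest (K a : ℝ) (g : ℝ → ℝ) (p : ℝ × ℝ) :
    dt (quarticTest K a g) p = deriv g p.1 := by
  simp [dt, quarticTest]

lemma isQuarticAt_quarticTest (K a : ℝ) (g : ℝ → ℝ) : IsQuarticAt (quarticTest K a g) a :=
  ⟨K, g, fun p _ => by rw [Even.pow_abs (by decide)]; rfl⟩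

lemma quarticTest_taylor {K a R r : ℝ} (hK : 0 ≤ K) {g : ℝ → ℝ} (hr1 : r ≤ 1)
    {p : ℝ × ℝ} (hR : |p.2 - a| ≤ R) (z : ℝ) (hz : |z| < r) :
    |quarticTest K a g (p.1, p.2 + z) - quarticTest K a g (p.1, p.2) -
      deriv (fun y => quarticTest K a g (p.1, y)) p.2 * z| ≤ K * (6 * R ^ 2 + 4 * R + 1) * z ^ 2 := by
  have hd : deriv (fun y => quarticTest K a g (p.1, y)) p.2 = 4 * K * (p.2 - a) ^ 3 :=
    (hasDerivAt_quartic K a (g p.1) p.2).deriv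
  rw [hd]
  have e : quarticTest K a g (p.1, p.2 + z) - quarticTest K a g (p.1, p.2) -
      4 * K * (p.2 - a) ^ 3 * z =
      K * (6 * (p.2 - a) ^ 2 + 4 * (p.2 - a) * z + z ^ 2) * z ^ 2 := by
    simp only [quarticTest]; ring
  rw [e, abs_mul, abs_mul, abs_of_nonneg hK, abs_of_nonneg (sq_nonneg z)]
  have hz1 : |z| ≤ 1 := by linarith
  have hR0 : 0 ≤ R := (abs_nonneg _).trans hR
  gcongr
  calc |6 * (p.2 - a) ^ 2 + 4 * (p.2 - a) * z + z ^ 2|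
      ≤ |6 * (p.2 - a) ^ 2| + |4 * (p.2 - a) * z| + |z ^ 2| := abs_add_three _ _ _
    _ = 6 * |p.2 - a| ^ 2 + 4 * |p.2 - a| * |z| + |z| ^ 2 := by
        simp [abs_mul]
    _ ≤ 6 * R ^ 2 + 4 * R * 1 + 1 ^ 2 := by gcongr
    _ = _ := by ring

lemma Irho_quarticTest_le {K a R r M : ℝ} (hK : 0 ≤ K) {g : ℝ → ℝ} (hr : 0 < r) (hr1 : r ≤ 1)
    {p : ℝ × ℝ} (hR : |p.2 - a| ≤ R) {w : ℝ → ℝ} (hM : ∀ y, |w y| ≤ M) :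
    Irho r (fun y => quarticTest K a g (p.1, y)) w p.2 ≤
      K * (6 * R ^ 2 + 4 * R + 1) * (2 * r) + 2 * M * tailMass r := by
  have hR0 : 0 ≤ R := (abs_nonneg _).trans hR
  have h1 := abs_integral_inner_le (f := fun y => quarticTest K a g (p.1, y)) hr.le
    (by positivity) (quarticTest_taylor hK (g := g) hr1 hR)
  have h2 := integral_div_sq_le (g := fun z => w (p.2 + z) - w p.2)
    (fun _ => abs_sub_le_two_mul hM _ _) hr
  exact add_le_add ((le_abs_self _).trans h1) ((le_abs_self _).trans h2)

/-- The inequality at quartic test functions, with an arbitrary radius. -/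
lemma WeakSub.quartic_test {ρ M : ℝ} {u : ℝ × ℝ → ℝ} (h : WeakSub ρ M u) (hρ : 0 < ρ) {K a : ℝ}
    (hK : 0 < K) {g : ℝ → ℝ} (hg : ContDiff ℝ 2 g) {p : ℝ × ℝ} (hp : p ∈ Q)
    (hmax : IsMaxOn (fun q => u q - quarticTest K a g q) Q p) {r : ℝ} (hr : 0 < r) :
    deriv g p.1 ≤ Irho r (fun y => quarticTest K a g (p.1, y)) (fun y => u (p.1, y)) p.2 *
      |4 * K * (p.2 - a) ^ 3| := by
  rw [← dt_quarticTest K a g p, ← dx_quarticTest K a g p]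
  have hφ := (contDiff_quarticTest K a hg).contDiffOn (s := Q)
  -- A quartic has zero slope only at its centre. There the right-hand side vanishes and the special
  -- quartic condition is exactly what is needed; elsewhere the slope condition applies, at any
  -- radius.
  by_cases hpa : p.2 = a
  · have h0 : dx (quarticTest K a g) p = 0 := by simp [dx_quarticTest, hpa]
    rw [h0, abs_zero, mul_zero]
    exact h.quartic _ hφ p hp hmax (hpa ▸ isQuarticAt_quarticTest K a g)
  · refine h.slope.radius h.usc_Q h.bdd hr hρ _ hφ p hp hmax ?_
    rw [dx_quarticTest]
    exact mul_ne_zero (by positivity) (pow_ne_zero _ (sub_ne_zero.2 hpa))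

/-- The speed of the quartic barriers. -/
noncomputable def barrierRate (K M : ℝ) : ℝ :=
  (K * (6 * (2 * M + 1) ^ 2 + 4 * (2 * M + 1) + 1) * (2 * 1) + 2 * M * tailMass 1) *
    (4 * K * (2 * M + 1) ^ 3) + 1

lemma one_le_barrierRate {K M : ℝ} (hK : 0 ≤ K) (hM : 0 ≤ M) : 1 ≤ barrierRate K M := by
  have := tailMass_nonneg 1
  have : 0 ≤ (K * (6 * (2 * M + 1) ^ 2 + 4 * (2 * M + 1) + 1) * (2 * 1) + 2 * M * tailMass 1) *
    (4 * K * (2 * M + 1) ^ 3) := by positivity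
  rw [barrierRate]; linarith

lemma abs_slope_quartic_le {K d R : ℝ} (hK : 0 ≤ K) (hd : |d| ≤ R) :
    |4 * K * d ^ 3| ≤ 4 * K * R ^ 3 := by
  rw [abs_mul, abs_mul, abs_of_nonneg hK, abs_pow, abs_of_nonneg (by norm_num : (0 : ℝ) ≤ 4)]
  gcongr

lemma WeakSub.le_barrier {ρ M : ℝ} {u : ℝ × ℝ → ℝ} (h : WeakSub ρ M u) (hρ : 0 < ρ) {K a c : ℝ}
    (hK : 1 ≤ K) (hc : -M ≤ c) (hinit : ∀ x, u (0, x) ≤ c + K * (x - a) ^ 4) {p₀ : ℝ × ℝ}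
    (hp₀ : p₀ ∈ Qbar) : u p₀ ≤ c + K * (p₀.2 - a) ^ 4 + barrierRate K M * p₀.1 := by
  have hM0 : 0 ≤ M := (abs_nonneg _).trans (h.bound p₀ hp₀)
  have hC := one_le_barrierRate (K := K) (by linarith) hM0
  set C := barrierRate K M with hCdef
  set R := 2 * M + 1 with hRdef
  by_contra! hlt
  set g : ℝ → ℝ := fun t => c + C * t with hgdef
  have hg : ContDiff ℝ 2 g := by rw [hgdef]; fun_prop
  set φ := quarticTest K a g with hφ
  have hφv : ∀ q, φ q = c + K * (q.2 - a) ^ 4 + C * q.1 := fun q => by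
    simp only [hφ, quarticTest, hgdef]; ring
  -- Since `u ≤ M`, `c ≥ -M` and `K, C ≥ 1`, a point where `u` exceeds the barrier satisfies `(x-a)⁴
  -- + t < 2M`. The positivity set is thus bounded and a maximum exists.
  have hfar : ∀ q ∈ Qbar, 0 < u q - φ q → q.1 ≤ R ∧ |q.2 - a| ≤ R := by
    intro q hq hpos
    have hq0 : 0 ≤ q.1 := hq
    have hu := (abs_le.1 (h.bound q hq)).2
    rw [hφv] at hpos
    have h4 : 0 ≤ K * (q.2 - a) ^ 4 := by positivity
    have hCt : q.1 ≤ C * q.1 := le_mul_of_one_le_left hq0 hC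
    refine ⟨by linarith, ?_⟩
    by_contra! hbig
    have h1 : R ^ 4 ≤ (q.2 - a) ^ 4 := by
      rw [← Even.pow_abs (by decide) (q.2 - a)]
      gcongr
    have h2 : R ≤ R ^ 4 := le_self_pow₀ (by linarith) (by norm_num)
    have h3 : (q.2 - a) ^ 4 ≤ K * (q.2 - a) ^ 4 := le_mul_of_one_le_left (by positivity) hK
    nlinarith
  set B : Set (ℝ × ℝ) := Icc 0 R ×ˢ Icc (a - R) (a + R) with hB
  have hBQ : B ⊆ Qbar := fun q hq => hq.1.1
  have hmem : ∀ q ∈ Qbar, 0 < u q - φ q → q ∈ B := fun q hq hpos => by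
    obtain ⟨h1, h2⟩ := hfar q hq hpos
    rw [abs_le] at h2
    exact ⟨⟨hq, h1⟩, ⟨by linarith, by linarith⟩⟩
  have hpos₀ : 0 < u p₀ - φ p₀ := by rw [hφv]; linarith
  have husc : UpperSemicontinuousOn (fun q => u q - φ q) B := by
    simp_rw [sub_eq_add_neg]
    exact (h.usc.mono hBQ).add
      ((contDiff_quarticTest K a hg).continuous.neg.upperSemicontinuous.upperSemicontinuousOn B)
  obtain ⟨p, hpB, hpmax⟩ := husc.exists_isMaxOn ⟨p₀, hmem p₀ hp₀ hpos₀⟩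
    (isCompact_Icc.prod isCompact_Icc)
  have hppos : 0 < u p - φ p := hpos₀.trans_le (le_of_isMaxOn hpmax (hmem p₀ hp₀ hpos₀))
  have hpt : 0 < p.1 := by
    rcases (mem_Qbar.1 (hBQ hpB)).lt_or_eq with h0 | h0
    · exact h0
    · exfalso
      have := hinit p.2
      have hp' : p = (0, p.2) := Prod.ext h0.symm rfl
      rw [hφv, ← h0, hp'] at hppos
      dsimp only at hppos
      linarith
  have hmax : IsMaxOn (fun q => u q - φ q) Q p := by
    intro q hq
    by_cases hqB : q ∈ B
    · exact hpmax hqB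
    · have : ¬ 0 < u q - φ q := fun h' => hqB (hmem q (Q_subset_Qbar hq) h')
      exact (not_lt.1 this).trans hppos.le
  -- The bounds below give `C ≤ C - 1`: the rate was defined as the largest possible right-hand side
  -- within distance `R` of the centre, plus one.
  have key := h.quartic_test hρ (by linarith) hg (mem_Q.2 hpt) hmax one_pos
  have hdg : deriv g p.1 = C := by
    have : HasDerivAt g C p.1 := by
      simpa [hgdef] using ((hasDerivAt_id p.1).const_mul C).const_add c
    exact this.deriv
  have hR := (hfar p (hBQ hpB) hppos).2
  have hI := Irho_quarticTest_le (K := K) (a := a) (by linarith) (g := g) one_pos le_rfl hR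
    (w := fun y => u (p.1, y)) (M := M) (fun y => h.bound _ (mem_Qbar.2 hpt.le))
  have hS := abs_slope_quartic_le (K := K) (by linarith) hR
  have hT := tailMass_nonneg 1
  have hfin := mul_le_mul hI hS (abs_nonneg _) (by positivity)
  rw [hdg] at key
  have : C = (K * (6 * R ^ 2 + 4 * R + 1) * (2 * 1) + 2 * M * tailMass 1) * (4 * K * R ^ 3) + 1 :=
    rfl
  linarith

/-- A modulus of continuity at time zero, uniform over subsolutions. -/
lemma exists_initial_rate {f : ℝ → ℝ} (hf : UniformContinuous f) {M : ℝ} (hM : ∀ x, |f x| ≤ M)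
    {ε : ℝ} (hε : 0 < ε) : ∃ K C, 1 ≤ K ∧ 0 ≤ C ∧ (∀ a x, f x ≤ f a + ε + K * (x - a) ^ 4) ∧
      (∀ a x, f a - ε - K * (x - a) ^ 4 ≤ f x) ∧
      ∀ ρ > 0, ∀ u, WeakSub ρ M u → (∀ x, u (0, x) ≤ f x) →
        ∀ p ∈ Qbar, u p ≤ f p.2 + ε + C * p.1 := by
  have hM0 : 0 ≤ M := (abs_nonneg _).trans (hM 0)
  obtain ⟨δ, hδ, hfδ⟩ := Metric.uniformContinuous_iff.1 hf ε hε
  -- Within `δ` the modulus of `f` gives `ε`; beyond `δ` the quartic already exceeds the total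
  -- oscillation `2M`.
  set K := max 1 (2 * M / δ ^ 4) with hK
  have hK1 : 1 ≤ K := le_max_left _ _
  have hmod : ∀ a x, |f x - f a| ≤ ε + K * (x - a) ^ 4 := by
    intro a x
    have h4 : 0 ≤ K * (x - a) ^ 4 := by positivity
    rcases lt_or_ge |x - a| δ with h | h
    · have h1 := hfδ (a := x) (b := a) h
      rw [Real.dist_eq] at h1
      linarith
    · have h1 : 2 * M ≤ K * (x - a) ^ 4 := by
        have h2 : δ ^ 4 ≤ (x - a) ^ 4 := by
          rw [← Even.pow_abs (by decide) (x - a)]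
          gcongr
        calc 2 * M = 2 * M / δ ^ 4 * δ ^ 4 := by field_simp
          _ ≤ K * (x - a) ^ 4 := by
            gcongr
            exact le_max_right _ _
      have h3 := abs_sub_le_two_mul hM a x
      linarith
  refine ⟨K, barrierRate K M, hK1, by linarith [one_le_barrierRate (K := K) (by linarith) hM0],
    fun a x => by linarith [(abs_le.1 (hmod a x)).2], fun a x => by
      linarith [(abs_le.1 (hmod a x)).1], fun ρ hρ u hu hu0 p hp => ?_⟩
  have := hu.le_barrier hρ (a := p.2) (c := f p.2 + ε) hK1
    (by linarith [(abs_le.1 (hM p.2)).1])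
    (fun x => (hu0 x).trans (by linarith [(abs_le.1 (hmod p.2 x)).2])) hp
  simpa using this

/-! ### Comparison by doubling of variables -/

lemma eventually_truncated_tail_le {r M : ℝ} (hr : 0 < r) (hM : 0 ≤ M) {ε : ℝ} (hε : 0 < ε) :
    ∀ᶠ β in 𝓝[>] (0 : ℝ),
      ∫ z in (Metric.ball (0 : ℝ) r)ᶜ, min (β * |z|) M / z ^ 2 ≤ ε := by
  have h : Tendsto (fun β : ℝ => ∫ z in (Metric.ball (0 : ℝ) r)ᶜ, min (β * |z|) M / z ^ 2)
      (𝓝[>] 0) (𝓝 (∫ z in (Metric.ball (0 : ℝ) r)ᶜ, (0 : ℝ))) := by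
    refine tendsto_integral_filter_of_dominated_convergence (fun z => M * (1 / z ^ 2))
      (Eventually.of_forall fun β => (Measurable.aestronglyMeasurable (by fun_prop))) ?_
      ((integrableOn_inv_sq hr).const_mul M) (ae_of_all _ fun z => ?_)
    · filter_upwards [self_mem_nhdsWithin] with β hβ
      refine ae_of_all _ fun z => ?_
      have h0 : 0 ≤ min (β * |z|) M := le_min (mul_nonneg (le_of_lt hβ) (abs_nonneg z)) hM
      rw [Real.norm_eq_abs, abs_of_nonneg (by positivity), mul_one_div]
      exact div_le_div_of_nonneg_right (min_le_right _ _) (sq_nonneg z)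
    · have hc : Continuous fun β : ℝ => min (β * |z|) M / z ^ 2 := by fun_prop
      have := hc.tendsto 0
      simp only [zero_mul, min_eq_left hM, zero_div] at this
      exact this.mono_left nhdsWithin_le_nhds
  rw [integral_zero] at h
  exact h.eventually_le_const hε

/-- The penalization in the doubling of variables. The auxiliary space variable `z` carries the
localization, so that the penalization is exactly quartic in the space variables `x` and `y`. -/
noncomputable def penalty (L η β : ℝ) (P : (ℝ × ℝ) × (ℝ × ℝ) × ℝ) : ℝ :=
  L * (P.1.2 - P.2.2) ^ 4 + L * (P.2.1.2 - P.2.2) ^ 4 + L * (P.1.1 - P.2.1.1) ^ 2 + η * P.1.1 +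
    β * √(1 + P.2.2 ^ 2)

lemma continuous_penalty (L η β : ℝ) : Continuous (penalty L η β) := by
  unfold penalty; fun_prop

lemma abs_lt_of_mul_pow_four_le {L δ M a : ℝ} (hL : 0 ≤ L) (hδ : 0 ≤ δ) (hLδ : 2 * M + 1 ≤ L * δ ^ 4)
    (ha : L * a ^ 4 ≤ 2 * M) : |a| < δ := by
  by_contra! h
  have : δ ^ 4 ≤ a ^ 4 := by
    rw [← Even.pow_abs (by decide) a]; gcongr
  nlinarith

lemma abs_le_sqrt_one_add_sq (z : ℝ) : |z| ≤ √(1 + z ^ 2) :=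
  Real.abs_le_sqrt (by linarith)

/-- Each term of the penalty is nonnegative, hence at most `2M`. The condition on `L` forces the
space variables within `δ` of `z`, and `δ ≤ 1` lets the same `L` control the quadratic time term. -/
lemma penalty_bounds {L η β M δ : ℝ} (hL : 0 ≤ L) (hη : 0 ≤ η) (hβ : 0 ≤ β) (hδ : 0 ≤ δ)
    (hδ1 : δ ≤ 1) (hLδ : 2 * M + 1 ≤ L * δ ^ 4) {P : (ℝ × ℝ) × (ℝ × ℝ) × ℝ} (h1 : P.1 ∈ Qbar)
    (hP : penalty L η β P ≤ 2 * M) :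
    |P.1.2 - P.2.2| < δ ∧ |P.2.1.2 - P.2.2| < δ ∧ |P.1.1 - P.2.1.1| < δ ∧ η * P.1.1 ≤ 2 * M ∧
      β * |P.2.2| ≤ 2 * M := by
  have a1 : 0 ≤ L * (P.1.2 - P.2.2) ^ 4 := by positivity
  have a2 : 0 ≤ L * (P.2.1.2 - P.2.2) ^ 4 := by positivity
  have a3 : 0 ≤ L * (P.1.1 - P.2.1.1) ^ 2 := by positivity
  have a4 : 0 ≤ η * P.1.1 := mul_nonneg hη h1
  have a5 : 0 ≤ β * √(1 + P.2.2 ^ 2) := by positivity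
  have a6 : β * |P.2.2| ≤ β * √(1 + P.2.2 ^ 2) :=
    mul_le_mul_of_nonneg_left (abs_le_sqrt_one_add_sq _) hβ
  unfold penalty at hP
  refine ⟨abs_lt_of_mul_pow_four_le hL hδ hLδ (by linarith),
    abs_lt_of_mul_pow_four_le hL hδ hLδ (by linarith), ?_, by linarith, by linarith⟩
  by_contra! h
  have h2 : δ ^ 2 ≤ (P.1.1 - P.2.1.1) ^ 2 := by
    rw [← sq_abs (P.1.1 - P.2.1.1)]; gcongr
  have h4 : δ ^ 4 ≤ δ ^ 2 := pow_le_pow_of_le_one hδ hδ1 (by norm_num)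
  nlinarith

/-- The drift `ηt` and the localization `β√(1+z²)` confine the points of positive value to a compact
box, where upper semicontinuity yields the maximum. The margins of one come from `δ ≤ 1`. -/
lemma exists_doubling_max {U W : ℝ × ℝ → ℝ} {M : ℝ} (hU : UpperSemicontinuousOn U Qbar)
    (hW : UpperSemicontinuousOn W Qbar) (hMU : ∀ p ∈ Qbar, |U p| ≤ M)
    (hMW : ∀ p ∈ Qbar, |W p| ≤ M) {L η β δ : ℝ} (hL : 0 ≤ L) (hη : 0 < η) (hβ : 0 < β)
    (hδ : 0 ≤ δ) (hδ1 : δ ≤ 1) (hLδ : 2 * M + 1 ≤ L * δ ^ 4) {P₀ : (ℝ × ℝ) × (ℝ × ℝ) × ℝ}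
    (h₀1 : P₀.1 ∈ Qbar) (h₀2 : P₀.2.1 ∈ Qbar)
    (hpos : 0 < U P₀.1 + W P₀.2.1 - penalty L η β P₀) :
    ∃ P : (ℝ × ℝ) × (ℝ × ℝ) × ℝ, P.1 ∈ Qbar ∧ P.2.1 ∈ Qbar ∧
      ∀ P' : (ℝ × ℝ) × (ℝ × ℝ) × ℝ, P'.1 ∈ Qbar → P'.2.1 ∈ Qbar →
        U P'.1 + W P'.2.1 - penalty L η β P' ≤ U P.1 + W P.2.1 - penalty L η β P := by
  set T := 2 * M / η with hT
  set Z := 2 * M / β with hZ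
  set B : Set ((ℝ × ℝ) × (ℝ × ℝ) × ℝ) := (Icc 0 T ×ˢ Icc (-Z - 1) (Z + 1)) ×ˢ
    ((Icc 0 (T + 1) ×ˢ Icc (-Z - 1) (Z + 1)) ×ˢ Icc (-Z) Z) with hB
  have hBc : IsCompact B := (isCompact_Icc.prod isCompact_Icc).prod
    ((isCompact_Icc.prod isCompact_Icc).prod isCompact_Icc)
  have hB1 : ∀ P ∈ B, P.1 ∈ Qbar := fun P hP => hP.1.1.1
  have hB2 : ∀ P ∈ B, P.2.1 ∈ Qbar := fun P hP => hP.2.1.1.1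
  have hmem : ∀ P : (ℝ × ℝ) × (ℝ × ℝ) × ℝ, P.1 ∈ Qbar → P.2.1 ∈ Qbar →
      0 < U P.1 + W P.2.1 - penalty L η β P → P ∈ B := by
    intro P h1 h2 h
    obtain ⟨b1, b2, b3, b4, b5⟩ := penalty_bounds (M := M) hL hη.le hβ.le hδ hδ1 hLδ h1
      (by linarith [(abs_le.1 (hMU _ h1)).2, (abs_le.1 (hMW _ h2)).2])
    rw [abs_lt] at b1 b2 b3
    have c4 : P.1.1 ≤ T := by rw [hT, le_div_iff₀ hη]; linarith
    have c5 : |P.2.2| ≤ Z := by rw [hZ, le_div_iff₀ hβ]; linarith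
    rw [abs_le] at c5
    exact ⟨⟨⟨h1, c4⟩, ⟨by linarith, by linarith⟩⟩, ⟨⟨h2, by linarith⟩, ⟨by linarith, by linarith⟩⟩,
      ⟨by linarith, by linarith⟩⟩
  have husc : UpperSemicontinuousOn (fun P => U P.1 + W P.2.1 + -penalty L η β P) B :=
    ((hU.comp continuous_fst.continuousOn hB1).add
      (hW.comp (g := fun P : (ℝ × ℝ) × (ℝ × ℝ) × ℝ => P.2.1) (by fun_prop) hB2)).add
      ((continuous_penalty L η β).neg.upperSemicontinuous.upperSemicontinuousOn B)
  have hP₀ := hmem P₀ h₀1 h₀2 hpos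
  obtain ⟨P, hPB, hPmax⟩ := husc.exists_isMaxOn ⟨P₀, hP₀⟩ hBc
  refine ⟨P, hB1 P hPB, hB2 P hPB, fun P' h1 h2 => ?_⟩
  by_cases hP' : P' ∈ B
  · exact hPmax hP'
  · have h3 : ¬ 0 < U P'.1 + W P'.2.1 - penalty L η β P' := fun h' => hP' (hmem P' h1 h2 h')
    have h4 : U P₀.1 + W P₀.2.1 + -penalty L η β P₀ ≤ U P.1 + W P.2.1 + -penalty L η β P :=
      hPmax hP₀
    linarith

/-- The algebra behind the contradiction in the comparison principle. -/
lemma no_doubling_max {η C L κ D β τ P N A₁ B₁ A B : ℝ} (hη : 0 < η) (hC : 0 ≤ C) (hL : 0 ≤ L)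
    (hκ : κ = η / (4 * (C + 1))) (hD : 0 ≤ D) (hLD : 4 * L * D ≤ η / 4) (hβκ : β ≤ κ)
    (hβD : β * (D + 2 * L / κ) ≤ η / 4) (hτ : |τ| ≤ 2 * L) (hP0 : 0 ≤ P) (hN0 : 0 ≤ N)
    (hP : P ≤ 4 * L) (hN : N ≤ 4 * L) (hPN : |P - N| ≤ β) (hA₁ : A₁ ≤ C) (hB₁ : B₁ ≤ C)
    (h1 : τ + η ≤ A₁ * P) (h2 : -τ ≤ B₁ * N) (h3 : τ + η ≤ A * P) (h4 : -τ ≤ B * N)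
    (hAB : A + B ≤ D) : False := by
  have hκ0 : 0 < κ := by rw [hκ]; positivity
  have hκC : 4 * C * κ < η := by
    have : κ * (4 * (C + 1)) = η := by rw [hκ]; field_simp
    nlinarith
  rw [abs_le] at hτ hPN
  have hA1 : A₁ * P ≤ C * P := by gcongr
  have hB1 : B₁ * N ≤ C * N := by gcongr
  -- If one slope is at most `κ`, the other is at most `κ + β ≤ 2κ`. Adding the first two
  -- inequalities then gives `η ≤ 3Cκ < η`.
  rcases le_or_gt P κ with hPκ | hPκ
  · nlinarith
  rcases le_or_gt N κ with hNκ | hNκ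
  · nlinarith
  -- Both slopes now exceed `κ`, so the bound on `τ` keeps `A` and `B` above `-S`. With `A + B ≤ D`,
  -- each of them is at most `D + S`.
  set S := 2 * L / κ with hS
  have hS0 : 0 ≤ S := by positivity
  have hSκ : S * κ = 2 * L := by rw [hS]; field_simp
  have hA : -S ≤ A := by
    by_contra! h
    nlinarith [mul_le_mul_of_nonneg_left hPκ.le hS0, mul_lt_mul_of_pos_right h (hκ0.trans hPκ)]
  have hB : -S ≤ B := by
    by_contra! h
    nlinarith [mul_le_mul_of_nonneg_left hNκ.le hS0, mul_lt_mul_of_pos_right h (hκ0.trans hNκ)]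
  have hsum : η ≤ A * P + B * N := by linarith
  have hDS : 0 ≤ D + S := by positivity
  -- With the smaller slope factored out, the sum `A + B` contributes at most `4LD ≤ η/4`. The
  -- difference of slopes contributes at most `β(D + S) ≤ η/4`, against a total of at least `η`.
  rcases le_total N P with h | h
  · have e : A * P + B * N = (A + B) * N + A * (P - N) := by ring
    have f1 : (A + B) * N ≤ D * (4 * L) :=
      (mul_le_mul_of_nonneg_right hAB hN0).trans (mul_le_mul_of_nonneg_left hN hD)
    have f2 : A * (P - N) ≤ (D + S) * β :=
      (mul_le_mul_of_nonneg_right (by linarith : A ≤ D + S) (by linarith)).trans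
        (mul_le_mul_of_nonneg_left hPN.2 hDS)
    nlinarith
  · have e : A * P + B * N = (A + B) * P + B * (N - P) := by ring
    have f1 : (A + B) * P ≤ D * (4 * L) :=
      (mul_le_mul_of_nonneg_right hAB hP0).trans (mul_le_mul_of_nonneg_left hP hD)
    have f2 : B * (N - P) ≤ (D + S) * β :=
      (mul_le_mul_of_nonneg_right (by linarith : B ≤ D + S) (by linarith)).trans
        (mul_le_mul_of_nonneg_left (by linarith) hDS)
    nlinarith

lemma sqrt_one_add_sq_sub_le (z h : ℝ) : √(1 + (z + h) ^ 2) - √(1 + z ^ 2) ≤ |h| := by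
  rw [sub_le_iff_le_add, Real.sqrt_le_left (by positivity)]
  have h1 := Real.sq_sqrt (show 0 ≤ 1 + z ^ 2 by positivity)
  have h2 := abs_le_sqrt_one_add_sq z
  have h3 : z * h ≤ |h| * √(1 + z ^ 2) := by
    calc z * h ≤ |z * h| := le_abs_self _
      _ = |h| * |z| := by rw [abs_mul, mul_comm]
      _ ≤ _ := by gcongr
  nlinarith [sq_abs h]

/-- First-order condition in the localization variable. -/
lemma abs_sub_le_of_penalty_max {L β a b x : ℝ} (hβ : 0 ≤ β)
    (hmax : ∀ z, -(L * (a - z) ^ 4 + L * (b - z) ^ 4 + β * √(1 + z ^ 2)) ≤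
      -(L * (a - x) ^ 4 + L * (b - x) ^ 4 + β * √(1 + x ^ 2))) :
    |(|4 * L * (a - x) ^ 3| - |4 * L * (b - x) ^ 3|)| ≤ β := by
  set G : ℝ → ℝ := fun z => L * (a - z) ^ 4 + L * (b - z) ^ 4 + β * √(1 + z ^ 2) with hG
  have hmin : IsLocalMin G x := Eventually.of_forall fun z => neg_le_neg_iff.1 (hmax z)
  have hx : (1 : ℝ) + x ^ 2 ≠ 0 := by positivity
  have hd : HasDerivAt G (-(4 * L * (a - x) ^ 3) - 4 * L * (b - x) ^ 3 +
      β * (x / √(1 + x ^ 2))) x := by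
    have d1 := (((hasDerivAt_id x).const_sub a).pow 4).const_mul L
    have d2 := (((hasDerivAt_id x).const_sub b).pow 4).const_mul L
    have d3 := ((((hasDerivAt_id x).pow 2).const_add 1).sqrt hx).const_mul β
    refine ((d1.add d2).add d3).congr_deriv ?_
    simp only [id, Pi.pow_apply]
    push_cast
    field_simp
    ring
  -- Criticality in `z` makes the two cubic slopes opposite up to `β` times a number of modulus at
  -- most one.
  have h0 := hmin.hasDerivAt_eq_zero hd
  have hs : |x / √(1 + x ^ 2)| ≤ 1 := by
    rw [abs_div, abs_of_nonneg (Real.sqrt_nonneg _)]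
    exact div_le_one_of_le₀ (abs_le_sqrt_one_add_sq x) (Real.sqrt_nonneg _)
  calc |(|4 * L * (a - x) ^ 3| - |4 * L * (b - x) ^ 3|)|
      = |(|4 * L * (a - x) ^ 3| - |-(4 * L * (b - x) ^ 3)|)| := by rw [abs_neg]
    _ ≤ |4 * L * (a - x) ^ 3 - -(4 * L * (b - x) ^ 3)| := abs_abs_sub_abs_le _ _
    _ = |β * (x / √(1 + x ^ 2))| := by congr 1; linarith
    _ ≤ β * 1 := by
      rw [abs_mul, abs_of_nonneg hβ]
      gcongr
    _ = β := mul_one β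

/-- Sum of the nonlocal terms at a maximum of the doubled functional. -/
lemma Irho_add_Irho_le {L M β r : ℝ} (hL : 0 ≤ L) (hr : 0 < r) (hr1 : r ≤ 1)
    {p q : ℝ × ℝ} {z : ℝ} (hp : |p.2 - z| ≤ 1) (hq : |q.2 - z| ≤ 1) {g₁ g₂ u w : ℝ → ℝ}
    (hu : Measurable u) (hw : Measurable w) (hMu : ∀ y, |u y| ≤ M) (hMw : ∀ y, |w y| ≤ M)
    (hβ : 0 ≤ β)
    (hmax : ∀ h, u (p.2 + h) - u p.2 + (w (q.2 + h) - w q.2) ≤ β * |h|) :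
    Irho r (fun y => quarticTest L z g₁ (p.1, y)) u p.2 +
      Irho r (fun y => quarticTest L z g₂ (q.1, y)) w q.2 ≤
      44 * L * r + ∫ z in (Metric.ball (0 : ℝ) r)ᶜ, min (β * |z|) (4 * M) / z ^ 2 := by
  have h1 := (le_abs_self _).trans <| abs_integral_inner_le
    (f := fun y => quarticTest L z g₁ (p.1, y)) hr.le (by positivity)
    (quarticTest_taylor hL (g := g₁) hr1 hp)
  have h2 := (le_abs_self _).trans <| abs_integral_inner_le
    (f := fun y => quarticTest L z g₂ (q.1, y)) hr.le (by positivity)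
    (quarticTest_taylor hL (g := g₂) hr1 hq)
  have i1 := integrableOn_outer hu hMu p.2 hr
  have i2 := integrableOn_outer hw hMw q.2 hr
  have hM0 : 0 ≤ M := (abs_nonneg _).trans (hMu 0)
  have i3 : IntegrableOn (fun z : ℝ => min (β * |z|) (4 * M) / z ^ 2)
      (Metric.ball (0 : ℝ) r)ᶜ :=
    integrableOn_div_sq_of_bound (g := fun z : ℝ => min (β * |z|) (4 * M)) (M := 4 * M)
      (by fun_prop) (fun z => by
        rw [abs_of_nonneg (le_min (by positivity) (by positivity))]; exact min_le_right _ _) hr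
  -- The growth `β|h|` is not integrable against `h⁻²` at infinity. The crude bound `4M` on the two
  -- increments truncates it.
  have h3 : (∫ h in (Metric.ball (0 : ℝ) r)ᶜ, (u (p.2 + h) - u p.2) / h ^ 2) +
      (∫ h in (Metric.ball (0 : ℝ) r)ᶜ, (w (q.2 + h) - w q.2) / h ^ 2) ≤
      ∫ z in (Metric.ball (0 : ℝ) r)ᶜ, min (β * |z|) (4 * M) / z ^ 2 := by
    rw [← integral_add i1 i2]
    refine setIntegral_mono_on (i1.add i2) i3 Metric.isOpen_ball.measurableSet.compl fun h _ => ?_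
    rw [← add_div]
    refine div_le_div_of_nonneg_right (le_min (hmax h) ?_) (sq_nonneg h)
    have a1 := (le_abs_self _).trans (abs_sub_le_two_mul hMu p.2 (p.2 + h))
    have a2 := (le_abs_self _).trans (abs_sub_le_two_mul hMw q.2 (q.2 + h))
    linarith
  rw [Irho, Irho]
  linarith

/-- **Comparison principle** for restricted subsolutions, in symmetric form. -/
theorem WeakSub.add_nonpos {ρ ρ' M : ℝ} {U W : ℝ × ℝ → ℝ} (hU : WeakSub ρ M U)
    (hW : WeakSub ρ' M W) (hρ : 0 < ρ) (hρ' : 0 < ρ') {f : ℝ → ℝ} (hf : UniformContinuous f)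
    (hfM : ∀ x, |f x| ≤ M) (hU0 : ∀ x, U (0, x) ≤ f x) (hW0 : ∀ x, W (0, x) ≤ -f x)
    {p₀ : ℝ × ℝ} (hp₀ : p₀ ∈ Qbar) : U p₀ + W p₀ ≤ 0 := by
  by_contra! hS
  set S := U p₀ + W p₀ with hSdef
  have hM0 : 0 ≤ M := (abs_nonneg _).trans (hfM 0)
  have ht0 : 0 ≤ p₀.1 := hp₀
  -- the behaviour at time zero
  obtain ⟨_, C₁, -, hC₁, -, -, hI₁⟩ := exists_initial_rate hf hfM (ε := S / 8) (by positivity)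
  obtain ⟨_, C₂, -, hC₂, -, -, hI₂⟩ := exists_initial_rate hf.neg (M := M)
    (fun x => by simpa using hfM x) (ε := S / 8) (by positivity)
  obtain ⟨δ₀, hδ₀, hfδ⟩ := Metric.uniformContinuous_iff.1 hf (S / 8) (by positivity)
  obtain ⟨δ, hδ, hδ1, hδδ, hδC₁, hδC₂⟩ : ∃ δ : ℝ, 0 < δ ∧ δ ≤ 1 ∧ 2 * δ ≤ δ₀ ∧
      C₁ * δ ≤ S / 8 ∧ C₂ * δ ≤ S / 8 := by
    refine ⟨min (min 1 (δ₀ / 2)) (min (S / 8 / (C₁ + 1)) (S / 8 / (C₂ + 1))), by positivity,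
      (min_le_left _ _).trans (min_le_left _ _), ?_, ?_, ?_⟩
    · have := (min_le_left (min 1 (δ₀ / 2)) (min (S / 8 / (C₁ + 1)) (S / 8 / (C₂ + 1)))).trans
        (min_le_right _ _)
      linarith
    · have := (min_le_right (min 1 (δ₀ / 2)) (min (S / 8 / (C₁ + 1)) (S / 8 / (C₂ + 1)))).trans
        (min_le_left _ _)
      rw [le_div_iff₀ (by positivity)] at this
      have h0 : 0 < min (min 1 (δ₀ / 2)) (min (S / 8 / (C₁ + 1)) (S / 8 / (C₂ + 1))) := by
        positivity
      linarith
    · have := (min_le_right (min 1 (δ₀ / 2)) (min (S / 8 / (C₁ + 1)) (S / 8 / (C₂ + 1)))).trans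
        (min_le_right _ _)
      rw [le_div_iff₀ (by positivity)] at this
      have h0 : 0 < min (min 1 (δ₀ / 2)) (min (S / 8 / (C₁ + 1)) (S / 8 / (C₂ + 1))) := by
        positivity
      linarith
  -- the parameters
  set L := (2 * M + 1) / δ ^ 4 with hL
  have hL0 : 0 < L := by positivity
  have hLδ : 2 * M + 1 ≤ L * δ ^ 4 := by rw [hL]; field_simp; rfl
  set η := S / (4 * (p₀.1 + 1)) with hη
  have hη0 : 0 < η := by positivity
  set C := 11 * L * (2 * 1) + 2 * M * tailMass 1 with hC
  have hT := tailMass_nonneg 1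
  have hC0 : 0 ≤ C := by positivity
  set κ := η / (4 * (C + 1)) with hκ
  have hκ0 : 0 < κ := by positivity
  set D := η / (16 * L) with hD
  have hD0 : 0 < D := by positivity
  set r := min 1 (D / 2 / (44 * L)) with hr
  have hr0 : 0 < r := by positivity
  have hr1 : r ≤ 1 := min_le_left _ _
  have hrD : 44 * L * r ≤ D / 2 := by
    have : r ≤ D / 2 / (44 * L) := min_le_right _ _
    rw [le_div_iff₀ (by positivity)] at this
    linarith
  have hpos1 : 0 < D + 2 * L / κ := by positivity
  have hsq : 0 < √(1 + p₀.2 ^ 2) := by positivity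
  -- `β` is chosen last, after `κ`, `D` and `r`. Its bounds control, in order, the tail integral,
  -- the small-slope case, the slope difference, and the loss at `p₀`. The radius `r` has taken half
  -- of `D` for the inner integrals, and the tail takes the other half.
  obtain ⟨β, hβtail, hβ0, hβκ, hβD, hβp⟩ : ∃ β : ℝ,
      (∫ z in (Metric.ball (0 : ℝ) r)ᶜ, min (β * |z|) (4 * M) / z ^ 2 ≤ D / 2) ∧ 0 < β ∧ β ≤ κ ∧
      β ≤ η / 4 / (D + 2 * L / κ) ∧ β ≤ S / 4 / √(1 + p₀.2 ^ 2) := by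
    have e := eventually_truncated_tail_le hr0 (by positivity : 0 ≤ 4 * M) (half_pos hD0)
    have e1 : ∀ c : ℝ, 0 < c → ∀ᶠ β in 𝓝[>] (0 : ℝ), β ≤ c := fun c hc =>
      nhdsWithin_le_nhds (eventually_le_nhds hc)
    have e0 : ∀ᶠ β in 𝓝[>] (0 : ℝ), 0 < β := self_mem_nhdsWithin
    exact (e.and (e0.and ((e1 κ hκ0).and ((e1 _ (by positivity)).and
      (e1 _ (by positivity)))))).exists
  rw [le_div_iff₀ hpos1] at hβD
  rw [le_div_iff₀ hsq] at hβp
  -- the maximum point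
  have hηp : η * p₀.1 ≤ S / 4 := by
    have : η * (4 * (p₀.1 + 1)) = S := by rw [hη]; field_simp
    nlinarith
  have hstart : S / 2 ≤ U p₀ + W p₀ - penalty L η β (p₀, p₀, p₀.2) := by
    simp only [penalty, sub_self]
    linarith
  obtain ⟨P, hP1, hP2, hmax⟩ := exists_doubling_max (P₀ := (p₀, p₀, p₀.2)) hU.usc hW.usc hU.bound
    hW.bound hL0.le hη0 hβ0 hδ.le hδ1 hLδ hp₀ hp₀ (lt_of_lt_of_le (by positivity) hstart)
  obtain ⟨p, q, z⟩ := P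
  dsimp only at hP1 hP2
  have hval : S / 2 ≤ U p + W q - penalty L η β (p, q, z) :=
    hstart.trans (hmax (p₀, p₀, p₀.2) hp₀ hp₀)
  have hUb := hU.bound p hP1
  have hWb := hW.bound q hP2
  obtain ⟨b1, b2, b3, b4, b5⟩ := penalty_bounds (M := M) hL0.le hη0.le hβ0.le hδ.le hδ1 hLδ
    (P := (p, q, z)) hP1 (by linarith [(abs_le.1 hUb).2, (abs_le.1 hWb).2])
  dsimp only at b1 b2 b3 b4 b5
  have hp0 : 0 ≤ p.1 := hP1
  have hq0 : 0 ≤ q.1 := hP2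
  have hpen : 0 ≤ penalty L η β (p, q, z) := by
    unfold penalty
    dsimp only
    positivity
  have hfpq : f p.2 - f q.2 < S / 8 := by
    have hd : dist p.2 q.2 < δ₀ := by
      rw [Real.dist_eq]
      calc |p.2 - q.2| = |(p.2 - z) - (q.2 - z)| := by congr 1; ring
        _ ≤ |p.2 - z| + |q.2 - z| := abs_sub _ _
        _ < δ₀ := by linarith
    have := hfδ hd
    rw [Real.dist_eq] at this
    exact (le_abs_self _).trans_lt this
  have hUp := hI₁ ρ hρ U hU hU0 p hP1
  have hWq : W q ≤ -f q.2 + S / 8 + C₂ * q.1 := hI₂ ρ' hρ' W hW hW0 q hP2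
  rw [abs_lt] at b3
  -- If one time is zero, the other is below `δ`. The initial bound at the first, the rate at the
  -- second and the modulus of `f` then give a sum below `3S/8`, less than the guaranteed `S/2`.
  have hpQ : p ∈ Q := by
    rcases hp0.lt_or_eq with h | h
    · exact h
    · exfalso
      have h1 : U p ≤ f p.2 := by
        have := hU0 p.2
        rwa [h] at this
      have h2 : C₂ * q.1 ≤ C₂ * δ := by gcongr; linarith
      linarith
  have hqQ : q ∈ Q := by
    rcases hq0.lt_or_eq with h | h
    · exact h
    · exfalso
      have h1 : W q ≤ -f q.2 := by
        have := hW0 q.2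
        rwa [h] at this
      have h2 : C₁ * p.1 ≤ C₁ * δ := by gcongr; linarith
      linarith
  -- the test functions
  set g₁ : ℝ → ℝ := fun t => L * (t - q.1) ^ 2 + η * t with hg₁
  set g₂ : ℝ → ℝ := fun s => L * (p.1 - s) ^ 2 with hg₂
  have hg₁c : ContDiff ℝ 2 g₁ := by rw [hg₁]; fun_prop
  have hg₂c : ContDiff ℝ 2 g₂ := by rw [hg₂]; fun_prop
  have hd₁ : deriv g₁ p.1 = 2 * L * (p.1 - q.1) + η := by
    have h := ((((hasDerivAt_id p.1).sub_const q.1).pow 2).const_mul L).add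
      ((hasDerivAt_id p.1).const_mul η)
    refine HasDerivAt.deriv (h.congr_deriv ?_)
    simp only [id]
    push_cast
    ring
  have hd₂ : deriv g₂ q.1 = -(2 * L * (p.1 - q.1)) := by
    have h := (((hasDerivAt_id q.1).const_sub p.1).pow 2).const_mul L
    refine HasDerivAt.deriv (h.congr_deriv ?_)
    simp only [id]
    push_cast
    ring
  have hm₁ : IsMaxOn (fun p' => U p' - quarticTest L z g₁ p') Q p := by
    intro p' hp'
    have := hmax (p', q, z) (Q_subset_Qbar hp') hP2
    simp only [penalty] at this
    change U p' - quarticTest L z g₁ p' ≤ U p - quarticTest L z g₁ p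
    simp only [quarticTest, hg₁]
    linarith
  have hm₂ : IsMaxOn (fun q' => W q' - quarticTest L z g₂ q') Q q := by
    intro q' hq'
    have := hmax (p, q', z) hP1 (Q_subset_Qbar hq')
    simp only [penalty] at this
    change W q' - quarticTest L z g₂ q' ≤ W q - quarticTest L z g₂ q
    simp only [quarticTest, hg₂]
    linarith
  have hUs : ∀ s : ℝ, 0 < s → _ := fun s hs => hU.quartic_test hρ hL0 hg₁c hpQ hm₁ (r := s) hs
  have hWs : ∀ s : ℝ, 0 < s → _ := fun s hs => hW.quartic_test hρ' hL0 hg₂c hqQ hm₂ (r := s) hs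
  rw [hd₁] at hUs
  rw [hd₂] at hWs
  have hMU : ∀ y, |U (p.1, y)| ≤ M := fun y => hU.bound _ (mem_Qbar.2 hp0)
  have hMW : ∀ y, |W (q.1, y)| ≤ M := fun y => hW.bound _ (mem_Qbar.2 hq0)
  have hIU := Irho_quarticTest_le hL0.le (g := g₁) one_pos le_rfl (b1.le.trans hδ1) hMU
  have hIW := Irho_quarticTest_le hL0.le (g := g₂) one_pos le_rfl (b2.le.trans hδ1) hMW
  -- Translating `x`, `y` and `z` by the same `h` leaves both quartics unchanged, so only the
  -- localization term varies, by at most `β|h|`.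
  have hAB := Irho_add_Irho_le (g₁ := g₁) (g₂ := g₂) hL0.le hr0 hr1 (b1.le.trans hδ1)
    (b2.le.trans hδ1) (measurable_slice hU.usc_Q hpQ) (measurable_slice hW.usc_Q hqQ) hMU hMW
    hβ0.le (fun h => by
      have h1 := hmax ((p.1, p.2 + h), (q.1, q.2 + h), z + h) hP1 hP2
      have h2 := mul_le_mul_of_nonneg_left (sqrt_one_add_sq_sub_le z h) hβ0.le
      simp only [penalty, add_sub_add_right_eq_sub] at h1
      simp only [Prod.mk.eta]
      linarith)
  have hPN := abs_sub_le_of_penalty_max (L := L) (a := p.2) (b := q.2) (x := z) hβ0.le (fun z' => by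
    have := hmax (p, q, z') hP1 hP2
    simp only [penalty] at this
    linarith)
  have hsl₁ := abs_slope_quartic_le hL0.le (b1.le.trans hδ1)
  have hsl₂ := abs_slope_quartic_le hL0.le (b2.le.trans hδ1)
  rw [one_pow, mul_one] at hsl₁ hsl₂
  refine no_doubling_max hη0 hC0 hL0.le hκ hD0.le ?_ hβκ hβD
    (τ := 2 * L * (p.1 - q.1)) ?_ (abs_nonneg _) (abs_nonneg _) hsl₁ hsl₂ hPN
    (hIU.trans (le_of_eq (by rw [hC]; ring))) (hIW.trans (le_of_eq (by rw [hC]; ring)))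
    (hUs 1 one_pos) (hWs 1 one_pos) (hUs r hr0) (hWs r hr0) (hAB.trans (by linarith))
  · rw [hD]
    apply le_of_eq
    field_simp
    ring
  · have hpq1 : |p.1 - q.1| ≤ 1 := abs_le.2 ⟨by linarith, by linarith⟩
    rw [abs_mul, abs_of_pos (by positivity : 0 < 2 * L)]
    exact mul_le_of_le_one_right (by positivity) hpq1

/-! ### Semicontinuous envelopes -/

lemma mem_closure_Q {p : ℝ × ℝ} (hp : p ∈ Qbar) : p ∈ closure Q := by
  have h : Tendsto (fun s : ℝ => ((p.1 + s, p.2) : ℝ × ℝ)) (𝓝[>] 0) (𝓝 p) := by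
    have hc : Continuous fun s : ℝ => ((p.1 + s, p.2) : ℝ × ℝ) := by fun_prop
    have := hc.tendsto 0
    simp only [add_zero, Prod.mk.eta] at this
    exact this.mono_left nhdsWithin_le_nhds
  refine mem_closure_of_tendsto h ?_
  filter_upwards [self_mem_nhdsWithin] with s hs
  exact mem_Q.2 (add_pos_of_nonneg_of_pos hp hs)

lemma neBot_nhdsWithin_Q {p : ℝ × ℝ} (hp : p ∈ Qbar) : (𝓝[Q] p).NeBot :=
  mem_closure_iff_nhdsWithin_neBot.1 (mem_closure_Q hp)

/-- No boundedness is needed: the real `sInf` is by definition minus the `sSup` of the negated set,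
default values included. -/
lemma lscEnv_eq_neg (u : ℝ × ℝ → ℝ) (p : ℝ × ℝ) : lscEnv u p = -uscEnv (fun q => -u q) p := by
  rw [lscEnv, uscEnv, liminf_eq, limsup_eq, Real.sInf_def, neg_neg]
  congr 1
  ext a
  simp

section envelope

variable {u : ℝ × ℝ → ℝ} {M : ℝ} {p : ℝ × ℝ}

lemma isBoundedUnder_le_of_bound (hM : ∀ q ∈ Q, |u q| ≤ M) (p : ℝ × ℝ) :
    IsBoundedUnder (· ≤ ·) (𝓝[Q] p) u :=
  isBoundedUnder_of_eventually_le
    (eventually_of_mem self_mem_nhdsWithin fun q hq => (abs_le.1 (hM q hq)).2)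

lemma isCoboundedUnder_le_of_bound (hM : ∀ q ∈ Q, |u q| ≤ M) (hp : p ∈ Qbar) :
    IsCoboundedUnder (· ≤ ·) (𝓝[Q] p) u := by
  have := neBot_nhdsWithin_Q hp
  exact (isBoundedUnder_of_eventually_ge
    (eventually_of_mem self_mem_nhdsWithin fun q hq => (abs_le.1 (hM q hq)).1)).isCoboundedUnder_le

lemma eventually_lt_of_uscEnv_lt (hM : ∀ q ∈ Q, |u q| ≤ M) {c : ℝ} (h : uscEnv u p < c) :
    ∀ᶠ q in 𝓝[Q] p, u q < c :=
  eventually_lt_of_limsup_lt h (isBoundedUnder_le_of_bound hM p)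

lemma uscEnv_le_of_eventually (hM : ∀ q ∈ Q, |u q| ≤ M) (hp : p ∈ Qbar) {c : ℝ}
    (h : ∀ᶠ q in 𝓝[Q] p, u q ≤ c) : uscEnv u p ≤ c :=
  limsup_le_of_le (isCoboundedUnder_le_of_bound hM hp) h

lemma frequently_lt_of_lt_uscEnv (hM : ∀ q ∈ Q, |u q| ≤ M) (hp : p ∈ Qbar) {c : ℝ}
    (h : c < uscEnv u p) : ∃ᶠ q in 𝓝[Q] p, c < u q :=
  frequently_lt_of_lt_limsup (isCoboundedUnder_le_of_bound hM hp) h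

lemma le_uscEnv (hM : ∀ q ∈ Q, |u q| ≤ M) (hp : p ∈ Q) : u p ≤ uscEnv u p := by
  by_contra! h
  have := eventually_lt_of_uscEnv_lt hM h
  rw [isOpen_Q.nhdsWithin_eq hp] at this
  exact lt_irrefl _ this.self_of_nhds

lemma abs_uscEnv_le (hM : ∀ q ∈ Q, |u q| ≤ M) (hp : p ∈ Qbar) : |uscEnv u p| ≤ M := by
  refine abs_le.2 ⟨?_, uscEnv_le_of_eventually hM hp
    (eventually_of_mem self_mem_nhdsWithin fun q hq => (abs_le.1 (hM q hq)).2)⟩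
  by_contra! h
  have := neBot_nhdsWithin_Q hp
  obtain ⟨q, h1, h2⟩ := ((eventually_lt_of_uscEnv_lt hM h).and self_mem_nhdsWithin).exists
  exact absurd (abs_le.1 (hM q h2)).1 (not_le.2 h1)

lemma upperSemicontinuousOn_uscEnv (hM : ∀ q ∈ Q, |u q| ≤ M) :
    UpperSemicontinuousOn (uscEnv u) Qbar := by
  intro p hp c hc
  obtain ⟨c', h1, h2⟩ := exists_between hc
  have h3 := eventually_nhdsWithin_iff.1 (eventually_lt_of_uscEnv_lt hM h1)
  have h4 := eventually_eventually_nhds.2 h3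
  filter_upwards [nhdsWithin_le_nhds h4, self_mem_nhdsWithin] with q hq hqQ
  exact (uscEnv_le_of_eventually hM hqQ
    ((eventually_nhdsWithin_iff.2 hq).mono fun _ h => h.le)).trans_lt h2

end envelope

/-! ### Unrestricted test functions -/

/-- The subsolution inequality at all test functions. -/
def FullSub (r : ℝ) (u : ℝ × ℝ → ℝ) : Prop :=
  ∀ φ : ℝ × ℝ → ℝ, ContDiffOn ℝ 2 φ Q → ∀ p ∈ Q, IsMaxOn (fun q => u q - φ q) Q p →
    dt φ p ≤ Hrho r φ u p

lemma FullSub.slopeSub {r : ℝ} {u : ℝ × ℝ → ℝ} (h : FullSub r u) : SlopeSub r u :=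
  fun φ hφ p hp hm _ => h φ hφ p hp hm

lemma dx_eq_zero_of_isQuarticAt {φ : ℝ × ℝ → ℝ} {p : ℝ × ℝ} (hp : p ∈ Q)
    (h : IsQuarticAt φ p.2) : dx φ p = 0 := by
  obtain ⟨c, g, hg⟩ := h
  have e : (fun y => φ (p.1, y)) = fun y => c * (y - p.2) ^ 4 + g p.1 := by
    funext y
    rw [hg (p.1, y) hp, Even.pow_abs (by decide)]
  rw [dx, e, (hasDerivAt_quartic c p.2 (g p.1) p.2).deriv]
  simp

lemma FullSub.quarticSub {r : ℝ} {u : ℝ × ℝ → ℝ} (h : FullSub r u) : QuarticSub u := by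
  intro φ hφ p hp hm hq
  simpa [Hrho, dx_eq_zero_of_isQuarticAt hp hq] using h φ hφ p hp hm

/-- Where the slope vanishes the Hamiltonian is zero for every radius, so only the nonzero-slope
case has content. -/
lemma FullSub.radius {r ρ : ℝ} {u : ℝ × ℝ → ℝ} (h : FullSub ρ u)
    (hu : UpperSemicontinuousOn u Q) (hb : BoundedOnQ u) (hr : 0 < r) (hρ : 0 < ρ) :
    FullSub r u := by
  intro φ hφ p hp hm
  by_cases hd : dx φ p = 0
  · simpa [Hrho, hd] using h φ hφ p hp hm
  · exact h.slopeSub.radius hu hb hr hρ φ hφ p hp hm hd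

lemma Irho_neg (r : ℝ) (φ w : ℝ → ℝ) (x : ℝ) :
    Irho r (fun y => -φ y) (fun y => -w y) x = -Irho r φ w x := by
  simp only [Irho, deriv.fun_neg, neg_add]
  rw [← integral_neg, ← integral_neg]
  congr 1 <;> (congr 1; funext z; ring)

lemma dx_neg (φ : ℝ × ℝ → ℝ) (p : ℝ × ℝ) : dx (fun q => -φ q) p = -dx φ p := by
  simp [dx]

lemma dt_neg (φ : ℝ × ℝ → ℝ) (p : ℝ × ℝ) : dt (fun q => -φ q) p = -dt φ p := by
  simp [dt]

lemma Hrho_neg (r : ℝ) (φ u : ℝ × ℝ → ℝ) (p : ℝ × ℝ) :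
    Hrho r (fun q => -φ q) (fun q => -u q) p = -Hrho r φ u p := by
  rw [Hrho, Hrho, dx_neg, abs_neg, Irho_neg, neg_mul]

lemma Irho_const_add (r c : ℝ) (φ w : ℝ → ℝ) (x : ℝ) :
    Irho r (fun y => c + φ y) w x = Irho r φ w x := by
  simp only [Irho, deriv_const_add, add_sub_add_left_eq_sub]

lemma Hrho_const_add (r c : ℝ) (φ u : ℝ × ℝ → ℝ) (p : ℝ × ℝ) :
    Hrho r (fun q => c + φ q) u p = Hrho r φ u p := by
  rw [Hrho, Hrho, Irho_const_add]
  simp [dx]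

/-! ### Stability of the nonlocal inequality -/

/-- The inner integrals converge by dominated convergence. In the outer one, `w n ≤ W` bounds the
integrand by increments of `W` that are only upper semicontinuous. Taking the maximum with the
limiting increment turns the one-sided bound into pointwise convergence. The disjunction on `w n` is
used only for measurability of slices. -/
lemma eventually_Irho_le {φ : ℝ × ℝ → ℝ} (hφ : ContDiffOn ℝ 2 φ Q) {p : ℝ × ℝ} (hp : p ∈ Q)
    {W : ℝ × ℝ → ℝ} {M : ℝ} (hW : UpperSemicontinuousOn W Q) (hWM : ∀ q ∈ Q, |W q| ≤ M)
    {w : ℕ → ℝ × ℝ → ℝ} (hw : ∀ n, UpperSemicontinuousOn (w n) Q ∨ LowerSemicontinuousOn (w n) Q)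
    (hwM : ∀ n, ∀ q ∈ Q, |w n q| ≤ M)
    (hle : ∀ n, ∀ q ∈ Q, w n q ≤ W q) {q : ℕ → ℝ × ℝ} (hq : ∀ n, q n ∈ Q)
    (hlim : Tendsto q atTop (𝓝 p)) (hval : Tendsto (fun n => w n (q n)) atTop (𝓝 (W p)))
    {r : ℝ} (hr : 0 < r) {ε : ℝ} (hε : 0 < ε) :
    ∀ᶠ n in atTop, Irho r (fun y => φ ((q n).1, y)) (fun y => w n ((q n).1, y)) (q n).2 ≤
      Irho r (fun y => φ (p.1, y)) (fun y => W (p.1, y)) p.2 + ε := by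
  have hmeas : ∀ n, Measurable fun y => w n ((q n).1, y) := by
    intro n
    rcases hw n with h | h
    · exact measurable_slice h (hq n)
    · have := measurable_slice (u := fun x => -w n x)
        (continuous_neg.comp_lowerSemicontinuousOn_antitone h fun _ _ h => neg_le_neg h) (hq n)
      simpa only [Pi.neg_def, neg_neg] using this.neg
  have hshift : ∀ z, Tendsto (fun n => (((q n).1, (q n).2 + z) : ℝ × ℝ)) atTop
      (𝓝 (p.1, p.2 + z)) := fun z =>
    ((by fun_prop : Continuous fun x : ℝ × ℝ => ((x.1, x.2 + z) : ℝ × ℝ)).tendsto p).comp hlim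
  -- the inner part converges
  have hin : Tendsto (fun n => ∫ z in Metric.ball (0 : ℝ) r, (φ ((q n).1, (q n).2 + z) -
      φ ((q n).1, (q n).2) - deriv (fun y => φ ((q n).1, y)) (q n).2 * z) / z ^ 2) atTop
      (𝓝 (∫ z in Metric.ball (0 : ℝ) r, (φ (p.1, p.2 + z) -
      φ (p.1, p.2) - deriv (fun y => φ (p.1, y)) p.2 * z) / z ^ 2)) := by
    obtain ⟨C, hC, hT⟩ := exists_taylor_bound hφ hp r
    have : IsFiniteMeasure (volume.restrict (Metric.ball (0 : ℝ) r)) :=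
      ⟨by simpa using measure_ball_lt_top (μ := volume) (x := (0 : ℝ)) (r := r)⟩
    refine tendsto_integral_filter_of_dominated_convergence (fun _ => C)
      (Eventually.of_forall fun n => (integrableOn_inner_slice hφ (hq n) r).aestronglyMeasurable)
      ?_ (integrable_const C) (ae_of_all _ fun z => ?_)
    · filter_upwards [hlim.eventually hT] with n hn
      refine (ae_restrict_iff' Metric.isOpen_ball.measurableSet).2 (ae_of_all _ fun z hz => ?_)
      have hz' : |z| < r := by simpa using hz
      exact abs_taylor_div_le hC (hn z hz'.le)
    · have hφc : ∀ x ∈ Q, ContinuousAt φ x := fun x hx =>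
        hφ.continuousOn.continuousAt (isOpen_Q.mem_nhds hx)
      have t1 := (hφc (p.1, p.2 + z) hp).tendsto.comp (hshift z)
      have t2 := (hφc p hp).tendsto.comp hlim
      have t3 := ((continuousOn_dx hφ).continuousAt (isOpen_Q.mem_nhds hp)).tendsto.comp hlim
      exact ((t1.sub t2).sub (t3.mul_const z)).div_const (z ^ 2)
  -- the outer part is dominated by a convergent integral
  set G : ℕ → ℝ → ℝ := fun n z =>
    max (W ((q n).1, (q n).2 + z) - w n (q n)) (W (p.1, p.2 + z) - W p) with hG
  have hGm : ∀ n, Measurable (G n) := fun n =>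
    (((measurable_slice hW (hq n)).comp (measurable_const_add (q n).2)).sub_const _).max
      (((measurable_slice hW hp).comp (measurable_const_add p.2)).sub_const _)
  have hGb : ∀ n z, |G n z| ≤ 2 * M := by
    intro n z
    have a1 := abs_le.1 (hWM ((q n).1, (q n).2 + z) (hq n))
    have a2 := abs_le.1 (hwM n (q n) (hq n))
    have a3 := abs_le.1 (hWM (p.1, p.2 + z) hp)
    have a4 := abs_le.1 (hWM p hp)
    exact abs_le.2 ⟨le_max_of_le_left (by linarith), max_le (by linarith) (by linarith)⟩
  have hout : Tendsto (fun n => ∫ z in (Metric.ball (0 : ℝ) r)ᶜ, G n z / z ^ 2) atTop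
      (𝓝 (∫ z in (Metric.ball (0 : ℝ) r)ᶜ, (W (p.1, p.2 + z) - W p) / z ^ 2)) := by
    refine tendsto_integral_of_dominated_convergence (fun z => 2 * M * (1 / z ^ 2))
      (fun n => ((hGm n).div (by fun_prop)).aestronglyMeasurable)
      ((integrableOn_inv_sq hr).const_mul _) (fun n => ae_of_all _ fun z => ?_)
      (ae_of_all _ fun z => ?_)
    · rw [Real.norm_eq_abs, abs_div, abs_of_nonneg (sq_nonneg z), mul_one_div]
      exact div_le_div_of_nonneg_right (hGb n z) (sq_nonneg z)
    · refine Tendsto.div_const ?_ (z ^ 2)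
      refine tendsto_order.2 ⟨fun c hc => Eventually.of_forall fun n => lt_max_of_lt_right hc,
        fun c hc => ?_⟩
      set e := (c - (W (p.1, p.2 + z) - W p)) / 2 with he
      have he0 : 0 < e := by rw [he]; linarith
      have h1 := hW (p.1, p.2 + z) hp (W (p.1, p.2 + z) + e) (by linarith)
      rw [isOpen_Q.nhdsWithin_eq (show ((p.1, p.2 + z) : ℝ × ℝ) ∈ Q from hp)] at h1
      filter_upwards [(hshift z).eventually h1,
        hval.eventually (eventually_gt_nhds (show W p - e < W p by linarith))] with n h2 h3
      exact max_lt (by linarith) hc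
  have hev := (hin.add hout).eventually (eventually_le_nhds (b := Irho r (fun y => φ (p.1, y))
    (fun y => W (p.1, y)) p.2 + ε) (by simp only [Irho, Prod.mk.eta]; linarith))
  filter_upwards [hev] with n hn
  refine le_trans (add_le_add le_rfl ?_) hn
  refine setIntegral_mono_on (integrableOn_outer (hmeas n) (M := M) (fun y => hwM n _ (hq n))
    (q n).2 hr) (integrableOn_div_sq_of_bound (hGm n) (hGb n) hr)
    Metric.isOpen_ball.measurableSet.compl fun z _ => div_le_div_of_nonneg_right ?_ (sq_nonneg z)
  refine le_max_of_le_left ?_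
  have := hle n ((q n).1, (q n).2 + z) (hq n)
  simp only [Prod.mk.eta]
  linarith

lemma dt_le_Hrho_of_tendsto {φ : ℝ × ℝ → ℝ} (hφ : ContDiffOn ℝ 2 φ Q) {p : ℝ × ℝ} (hp : p ∈ Q)
    {W : ℝ × ℝ → ℝ} {M : ℝ} (hW : UpperSemicontinuousOn W Q) (hWM : ∀ q ∈ Q, |W q| ≤ M)
    {w : ℕ → ℝ × ℝ → ℝ} (hw : ∀ n, UpperSemicontinuousOn (w n) Q ∨ LowerSemicontinuousOn (w n) Q)
    (hwM : ∀ n, ∀ q ∈ Q, |w n q| ≤ M)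
    (hle : ∀ n, ∀ q ∈ Q, w n q ≤ W q) {q : ℕ → ℝ × ℝ} (hq : ∀ n, q n ∈ Q)
    (hlim : Tendsto q atTop (𝓝 p)) (hval : Tendsto (fun n => w n (q n)) atTop (𝓝 (W p)))
    {r : ℝ} (hr : 0 < r) (h : ∀ᶠ n in atTop, dt φ (q n) ≤ Hrho r φ (w n) (q n)) :
    dt φ p ≤ Hrho r φ W p := by
  have t1 := ((continuousOn_dt hφ).continuousAt (isOpen_Q.mem_nhds hp)).tendsto.comp hlim
  have t2 := ((continuousOn_dx hφ).continuousAt (isOpen_Q.mem_nhds hp)).tendsto.comp hlim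
  have key : ∀ ε > 0, dt φ p ≤
      (Irho r (fun y => φ (p.1, y)) (fun y => W (p.1, y)) p.2 + ε) * |dx φ p| := by
    intro ε hε
    refine le_of_tendsto_of_tendsto t1 (t2.abs.const_mul _) ?_
    filter_upwards [h, eventually_Irho_le hφ hp hW hWM hw hwM hle hq hlim hval hr hε] with n h1 h2
    exact h1.trans (mul_le_mul_of_nonneg_right h2 (abs_nonneg _))
  have hc : Tendsto (fun ε => (Irho r (fun y => φ (p.1, y)) (fun y => W (p.1, y)) p.2 + ε) *
      |dx φ p|) (𝓝[>] (0 : ℝ)) (𝓝 (Hrho r φ W p)) := by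
    have := (by fun_prop : Continuous fun ε : ℝ =>
      (Irho r (fun y => φ (p.1, y)) (fun y => W (p.1, y)) p.2 + ε) * |dx φ p|).tendsto 0
    rw [add_zero] at this
    exact this.mono_left nhdsWithin_le_nhds
  refine ge_of_tendsto hc ?_
  filter_upwards [self_mem_nhdsWithin] with ε hε using key ε hε

/-! ### Strict test functions -/

/-- The gauge used to make contact points strict. -/
def gauge (p q : ℝ × ℝ) : ℝ := (q.2 - p.2) ^ 4 + (q.1 - p.1) ^ 2

lemma gauge_nonneg (p q : ℝ × ℝ) : 0 ≤ gauge p q := by unfold gauge; positivity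

lemma exists_gauge_lt_subset {p : ℝ × ℝ} {s : Set (ℝ × ℝ)} (hs : s ∈ 𝓝 p) :
    ∃ c > 0, ∀ q, gauge p q < c → q ∈ s := by
  obtain ⟨ε, hε, hb⟩ := Metric.mem_nhds_iff.1 hs
  refine ⟨min (ε ^ 4) (ε ^ 2), by positivity, fun q hq => hb ?_⟩
  have h1 := hq.trans_le (min_le_left _ _)
  have h2 := hq.trans_le (min_le_right _ _)
  unfold gauge at h1 h2
  have a1 : 0 ≤ (q.2 - p.2) ^ 4 := by positivity
  rw [Metric.mem_ball, Prod.dist_eq, max_lt_iff, Real.dist_eq, Real.dist_eq]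
  constructor
  · exact abs_lt_of_sq_lt_sq (by linarith) hε.le
  · refine lt_of_pow_lt_pow_left₀ 4 hε.le ?_
    rw [Even.pow_abs (by decide)]
    nlinarith [sq_nonneg (q.1 - p.1)]

lemma tendsto_of_gauge {p : ℝ × ℝ} {q : ℕ → ℝ × ℝ} {e : ℕ → ℝ} (he : Tendsto e atTop (𝓝 0))
    (h : ∀ᶠ n in atTop, gauge p (q n) ≤ e n) : Tendsto q atTop (𝓝 p) := by
  intro s hs
  obtain ⟨c, hc, hcs⟩ := exists_gauge_lt_subset hs
  refine mem_map.2 ?_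
  filter_upwards [h, he.eventually (eventually_lt_nhds hc)] with n h1 h2
  exact hcs _ (h1.trans_lt h2)

/-- Adding `a * gauge p` to a test function makes the contact strict and leaves the first
derivatives at `p` unchanged. The nonlocal term grows only by `a` times a constant, which disappears
as `a → 0`. -/
lemma fullSub_of_strict {r : ℝ} {V : ℝ × ℝ → ℝ}
    (h : ∀ φ : ℝ × ℝ → ℝ, ContDiffOn ℝ 2 φ Q → ∀ p ∈ Q, ∀ a > 0,
      (∀ q ∈ Q, V q - φ q + a * gauge p q ≤ V p - φ p) → dt φ p ≤ Hrho r φ V p) :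
    FullSub r V := by
  intro φ hφ p hp hmax
  set k := ∫ z in Metric.ball (0 : ℝ) r, z ^ 4 / z ^ 2 with hk
  have key : ∀ a > 0, dt φ p ≤
      (Irho r (fun y => φ (p.1, y)) (fun y => V (p.1, y)) p.2 + a * k) * |dx φ p| := by
    intro a ha
    set φa : ℝ × ℝ → ℝ := fun q => φ q + a * gauge p q with hφa
    have hga : ContDiff ℝ 2 fun q => a * gauge p q := by unfold gauge; fun_prop
    have hφac : ContDiffOn ℝ 2 φa Q := hφ.add hga.contDiffOn
    have d2 : HasDerivAt (fun y => a * gauge p (p.1, y)) 0 p.2 := by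
      have := hasDerivAt_quartic a p.2 0 p.2
      simpa [gauge] using this
    have d1 : HasDerivAt (fun s => a * gauge p (s, p.2)) 0 p.1 := by
      have := ((((hasDerivAt_id p.1).sub_const p.1).pow 2).const_mul a)
      simpa [gauge] using this
    have hdx : dx φa p = dx φ p := by
      rw [dx_eq_fderiv hφ hp]
      exact (((hasDerivAt_space hφ hp).add d2).congr_deriv (add_zero _)).deriv
    have hdt : dt φa p = dt φ p := by
      rw [dt_eq_fderiv hφ hp]
      exact (((hasDerivAt_time hφ hp).add d1).congr_deriv (add_zero _)).deriv
    have h1 := h φa hφac p hp a ha fun q hq => by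
      have := le_of_isMaxOn hmax hq
      simp only [hφa, gauge, sub_self]
      linarith
    rw [hdt, Hrho, hdx] at h1
    convert h1 using 2
    have hd' : deriv (fun y => φa (p.1, y)) p.2 = deriv (fun y => φ (p.1, y)) p.2 := hdx
    rw [Irho, Irho, hd']
    have hki : IntegrableOn (fun z : ℝ => a * (z ^ 4 / z ^ 2)) (Metric.ball 0 r) := by
      have : IntegrableOn (fun z : ℝ => a * z ^ 2) (Metric.ball 0 r) :=
        ((by fun_prop : Continuous fun z : ℝ => a * z ^ 2).continuousOn.integrableOn_compact
          (isCompact_closedBall 0 r)).mono_set Metric.ball_subset_closedBall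
      refine this.congr_fun (fun z _ => ?_) Metric.isOpen_ball.measurableSet
      rcases eq_or_ne z 0 with rfl | hz
      · simp
      · field_simp
    have e : ∫ z in Metric.ball (0 : ℝ) r, (φa (p.1, p.2 + z) - φa (p.1, p.2) -
        deriv (fun y => φ (p.1, y)) p.2 * z) / z ^ 2 =
        (∫ z in Metric.ball (0 : ℝ) r, (φ (p.1, p.2 + z) - φ (p.1, p.2) -
        deriv (fun y => φ (p.1, y)) p.2 * z) / z ^ 2) + a * k := by
      rw [hk, ← integral_const_mul, ← integral_add (integrableOn_inner_slice hφ hp r) hki]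
      congr 1
      funext z
      simp only [hφa, gauge, sub_self, add_sub_cancel_left]
      ring
    rw [e]
    ring
  have hc : Tendsto (fun a => (Irho r (fun y => φ (p.1, y)) (fun y => V (p.1, y)) p.2 + a * k) *
      |dx φ p|) (𝓝[>] (0 : ℝ)) (𝓝 (Hrho r φ V p)) := by
    have := (by fun_prop : Continuous fun a : ℝ =>
      (Irho r (fun y => φ (p.1, y)) (fun y => V (p.1, y)) p.2 + a * k) * |dx φ p|).tendsto 0
    rw [zero_mul, add_zero] at this
    exact this.mono_left nhdsWithin_le_nhds
  refine ge_of_tendsto hc ?_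
  filter_upwards [self_mem_nhdsWithin] with ε hε using key ε hε

/-! ### Perron's method -/

lemma tendsto_inv_nat_succ : Tendsto (fun n : ℕ => 1 / ((n : ℝ) + 1)) atTop (𝓝 0) :=
  tendsto_one_div_add_atTop_nhds_zero_nat

/-- The upper envelope of a supremum of subsolutions is a subsolution. -/
theorem fullSub_uscEnv_of_sup {r M : ℝ} (hr : 0 < r) {F : Set (ℝ × ℝ → ℝ)}
    (hF : ∀ w ∈ F, UpperSemicontinuousOn w Q ∧ (∀ q ∈ Q, |w q| ≤ M) ∧ FullSub r w)
    {u : ℝ × ℝ → ℝ} (huM : ∀ q ∈ Q, |u q| ≤ M) (hub : ∀ w ∈ F, ∀ q ∈ Q, w q ≤ u q)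
    (hlub : ∀ q ∈ Q, ∀ c < u q, ∃ w ∈ F, c < w q) : FullSub r (uscEnv u) := by
  refine fullSub_of_strict fun φ hφ p hp a ha hstrict => ?_
  set V := uscEnv u with hV
  have hVusc : UpperSemicontinuousOn V Q := (upperSemicontinuousOn_uscEnv huM).mono Q_subset_Qbar
  have hVM : ∀ q ∈ Q, |V q| ≤ M := fun q hq => abs_uscEnv_le huM (Q_subset_Qbar hq)
  have hφc : ContinuousAt φ p := hφ.continuousOn.continuousAt (isOpen_Q.mem_nhds hp)
  -- an approximating sequence
  have hseq : ∀ n : ℕ, ∃ w ∈ F, ∃ x ∈ Q, dist x p < 1 / ((n : ℝ) + 1) ∧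
      V p - 1 / ((n : ℝ) + 1) < w x := by
    intro n
    have hn : (0 : ℝ) < 1 / ((n : ℝ) + 1) := by positivity
    have hfr := frequently_lt_of_lt_uscEnv huM (Q_subset_Qbar hp)
      (show V p - 1 / ((n : ℝ) + 1) < uscEnv u p by rw [← hV]; linarith)
    have hball : ∀ᶠ x in 𝓝[Q] p, dist x p < 1 / ((n : ℝ) + 1) :=
      nhdsWithin_le_nhds (Metric.ball_mem_nhds p hn)
    obtain ⟨x, h1, h2, h3⟩ := (hfr.and_eventually (hball.and self_mem_nhdsWithin)).exists
    obtain ⟨w, hw, hwx⟩ := hlub x h3 _ h1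
    exact ⟨w, hw, x, h3, h2, hwx⟩
  choose w hwF x hxQ hxp hwx using hseq
  have hxlim : Tendsto x atTop (𝓝 p) :=
    tendsto_iff_dist_tendsto_zero.2 (squeeze_zero (fun _ => dist_nonneg) (fun n => (hxp n).le)
      tendsto_inv_nat_succ)
  have hwV : ∀ n, ∀ q ∈ Q, w n q ≤ V q := fun n q hq =>
    (hub _ (hwF n) q hq).trans (le_uscEnv huM hq)
  -- maxima on a compact neighbourhood
  have hp0 : 0 < p.1 := hp
  set K : Set (ℝ × ℝ) := Icc (p.1 / 2) (p.1 + 1) ×ˢ Icc (p.2 - 1) (p.2 + 1) with hK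
  have hKQ : K ⊆ Q := fun q hq => mem_Q.2 ((half_pos hp0).trans_le hq.1.1)
  have hKn : K ∈ 𝓝 p := prod_mem_nhds (Icc_mem_nhds (by linarith) (by linarith))
    (Icc_mem_nhds (by linarith) (by linarith))
  have hKc : IsCompact K := isCompact_Icc.prod isCompact_Icc
  have hmaxK : ∀ n, ∃ q ∈ K, IsMaxOn (fun q => w n q - φ q) K q := by
    intro n
    refine UpperSemicontinuousOn.exists_isMaxOn ⟨p, mem_of_mem_nhds hKn⟩ hKc ?_
    simp_rw [sub_eq_add_neg]
    exact ((hF _ (hwF n)).1.mono hKQ).add (hφ.continuousOn.mono hKQ).neg.upperSemicontinuousOn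
  choose q hqK hqmax using hmaxK
  set E : ℕ → ℝ := fun n => 1 / ((n : ℝ) + 1) + (φ (x n) - φ p) with hE
  have hElim : Tendsto E atTop (𝓝 0) := by
    have := tendsto_inv_nat_succ.add ((hφc.tendsto.comp hxlim).sub_const (φ p))
    rw [sub_self, add_zero] at this
    exact this
  have hlow : ∀ᶠ n in atTop, V p - φ p - E n ≤ w n (q n) - φ (q n) := by
    filter_upwards [hxlim.eventually_mem hKn] with n hn
    have h1 := le_of_isMaxOn (hqmax n) hn
    have h2 := hwx n
    simp only [hE]
    linarith
  obtain ⟨c, hc, hcK⟩ := exists_gauge_lt_subset hKn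
  have hgl : ∀ n, ∀ y ∈ Q, w n y - φ y + a * gauge p y ≤ V p - φ p := fun n y hy => by
    linarith [hstrict y hy, hwV n y hy]
  -- Test functions need global maxima. Outside `K` the strictness costs at least `a * c`, which
  -- eventually exceeds the approximation error `E n`, so the maximum over `K` is global.
  have hmaxQ : ∀ᶠ n in atTop, IsMaxOn (fun q => w n q - φ q) Q (q n) := by
    filter_upwards [hlow, hElim.eventually (eventually_lt_nhds (mul_pos ha hc))] with n h1 h2
    intro y hy
    by_cases hyK : y ∈ K
    · exact hqmax n hyK
    · have h3 : c ≤ gauge p y := not_lt.1 fun h' => hyK (hcK y h')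
      have h4 := hgl n y hy
      have h5 := mul_le_mul_of_nonneg_left h3 ha.le
      change w n y - φ y ≤ w n (q n) - φ (q n)
      linarith
  have hqlim : Tendsto q atTop (𝓝 p) := by
    have hE' : Tendsto (fun n => E n / a) atTop (𝓝 0) := by simpa using hElim.div_const a
    refine tendsto_of_gauge hE' ?_
    filter_upwards [hlow] with n h1
    rw [le_div_iff₀ ha]
    linarith [hgl n (q n) (hKQ (hqK n))]
  have hφq : Tendsto (fun n => φ (q n)) atTop (𝓝 (φ p)) := hφc.tendsto.comp hqlim
  have hval : Tendsto (fun n => w n (q n)) atTop (𝓝 (V p)) := by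
    have l1 : Tendsto (fun n => V p - φ p - E n + φ (q n)) atTop (𝓝 (V p)) := by
      have := (hElim.const_sub (V p - φ p)).add hφq
      simpa using this
    have l2 : Tendsto (fun n => V p - φ p + φ (q n)) atTop (𝓝 (V p)) := by
      have := hφq.const_add (V p - φ p)
      simpa using this
    refine tendsto_of_tendsto_of_tendsto_of_le_of_le' l1 l2 ?_ ?_
    · filter_upwards [hlow] with n h1
      linarith
    · refine Eventually.of_forall fun n => ?_
      have h1 := hgl n (q n) (hKQ (hqK n))
      have h2 := mul_nonneg ha.le (gauge_nonneg p (q n))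
      linarith
  refine dt_le_Hrho_of_tendsto hφ hp hVusc hVM (fun n => Or.inl (hF _ (hwF n)).1)
    (fun n => (hF _ (hwF n)).2.1) hwV (fun n => hKQ (hqK n)) hqlim hval hr ?_
  filter_upwards [hmaxQ] with n hn using (hF _ (hwF n)).2.2 φ hφ (q n) (hKQ (hqK n)) hn

/-- The class of subsolutions below the initial datum `f`. -/
structure PerronSub (M : ℝ) (f : ℝ → ℝ) (w : ℝ × ℝ → ℝ) : Prop where
  usc : UpperSemicontinuousOn w Qbar
  bound : ∀ p ∈ Qbar, |w p| ≤ M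
  sub : FullSub 1 w
  init : ∀ x, w (0, x) ≤ f x

lemma PerronSub.weakSub {M : ℝ} {f : ℝ → ℝ} {w : ℝ × ℝ → ℝ} (h : PerronSub M f w) :
    WeakSub 1 M w :=
  ⟨h.usc, h.bound, h.sub.slopeSub, h.sub.quarticSub⟩

/-- Monotonicity of the Hamiltonian at contact points. -/
lemma Hrho_le_of_touch {r : ℝ} (hr : 0 < r) {φ ψ v w : ℝ × ℝ → ℝ} (hφ : ContDiffOn ℝ 2 φ Q)
    (hψ : ContDiffOn ℝ 2 ψ Q) {p : ℝ × ℝ} (hp : p ∈ Q) (hdx : dx ψ p = dx φ p)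
    (hψφ : ∀ q ∈ Q, ψ q - φ q ≤ ψ p - φ p) {M : ℝ} (hv : UpperSemicontinuousOn v Q)
    (hvM : ∀ q ∈ Q, |v q| ≤ M) (hw : UpperSemicontinuousOn w Q) (hwM : ∀ q ∈ Q, |w q| ≤ M)
    (hvw : ∀ q ∈ Q, v q - w q ≤ v p - w p) : Hrho r ψ v p ≤ Hrho r φ w p := by
  rw [Hrho, Hrho, hdx]
  refine mul_le_mul_of_nonneg_right ?_ (abs_nonneg _)
  refine Irho_mono (integrableOn_inner_slice hψ hp r) (integrableOn_inner_slice hφ hp r)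
    (integrableOn_outer (measurable_slice hv hp) (M := M) (fun y => hvM _ hp) _ hr)
    (integrableOn_outer (measurable_slice hw hp) (M := M) (fun y => hwM _ hp) _ hr) hdx
    (fun z _ => ?_) (fun z _ => ?_)
  · have := hψφ (p.1, p.2 + z) hp
    simp only [Prod.mk.eta]
    linarith
  · have := hvw (p.1, p.2 + z) hp
    simp only [Prod.mk.eta]
    linarith

lemma dx_dt_eq_zero_of_isMinOn {φ : ℝ × ℝ → ℝ} (hφ : ContDiffOn ℝ 2 φ Q) {p : ℝ × ℝ} (hp : p ∈ Q)
    (h : ∀ q ∈ Q, φ p ≤ φ q) : dx φ p = 0 ∧ dt φ p = 0 := by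
  have := dx_eq_dt_eq_of_isMaxOn hφ (ψ := fun _ => 0) contDiffOn_const hp
    (fun q hq => show (0 : ℝ) - φ q ≤ 0 - φ p by linarith [h q hq])
  simpa [dx, dt] using this

open Classical in
/-- The bump of a subsolution by a test function. -/
noncomputable def bump (V ψ : ℝ × ℝ → ℝ) (q : ℝ × ℝ) : ℝ := if q ∈ Q then max (V q) (ψ q) else V q

lemma bump_of_mem {V ψ : ℝ × ℝ → ℝ} {q : ℝ × ℝ} (hq : q ∈ Q) : bump V ψ q = max (V q) (ψ q) :=
  if_pos hq

lemma bump_of_le {V ψ : ℝ × ℝ → ℝ} {q : ℝ × ℝ} (h : ψ q ≤ V q) : bump V ψ q = V q := by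
  unfold bump; split_ifs
  · exact max_eq_left h
  · rfl

lemma le_bump (V ψ : ℝ × ℝ → ℝ) (q : ℝ × ℝ) : V q ≤ bump V ψ q := by
  unfold bump; split_ifs
  · exact le_max_left _ _
  · rfl

lemma upperSemicontinuousOn_bump {V ψ : ℝ × ℝ → ℝ} (hV : UpperSemicontinuousOn V Qbar)
    (hψ : ContinuousOn ψ Q) {τ : ℝ} (hτ : 0 < τ) (hle : ∀ q ∈ Q, q.1 < τ → ψ q ≤ V q) :
    UpperSemicontinuousOn (bump V ψ) Qbar := by
  intro q hq c hc
  rcases (mem_Qbar.1 hq).lt_or_eq with h0 | h0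
  · have hqQ : q ∈ Q := h0
    rw [bump_of_mem hqQ, max_lt_iff] at hc
    have h1 := (hV.mono Q_subset_Qbar) q hqQ c hc.1
    rw [isOpen_Q.nhdsWithin_eq hqQ] at h1
    have h2 := (hψ.continuousAt (isOpen_Q.mem_nhds hqQ)).eventually (eventually_lt_nhds hc.2)
    refine nhdsWithin_le_nhds ?_
    filter_upwards [h1, h2, isOpen_Q.mem_nhds hqQ] with y a b d
    rw [bump_of_mem d]
    exact max_lt a b
  · have hqQ : q ∉ Q := fun h => (mem_Q.1 h).ne h0
    have hc' : V q < c := (le_bump V ψ q).trans_lt hc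
    have h1 : ∀ᶠ y : ℝ × ℝ in 𝓝[Qbar] q, y.1 < τ :=
      nhdsWithin_le_nhds (continuous_fst.continuousAt.eventually (eventually_lt_nhds
        (by rw [← h0]; exact hτ)))
    filter_upwards [hV q hq c hc', h1] with y a b
    by_cases hy : y ∈ Q
    · rwa [bump_of_le (hle y hy b)]
    · rwa [bump, if_neg hy]

/-- If a bump of the Perron solution is not a subsolution, then the failure occurs at a point where
the bump is active, and there the bumping function itself violates the inequality. -/
lemma exists_of_not_fullSub_bump {M : ℝ} {V ψ : ℝ × ℝ → ℝ} (hV : UpperSemicontinuousOn V Q)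
    (hVM : ∀ q ∈ Q, |V q| ≤ M) (hVsub : FullSub 1 V) (hψ : ContDiffOn ℝ 2 ψ Q)
    (hw : UpperSemicontinuousOn (bump V ψ) Q) (hwM : ∀ q ∈ Q, |bump V ψ q| ≤ M)
    (hnot : ¬ FullSub 1 (bump V ψ)) :
    ∃ q ∈ Q, V q < ψ q ∧ Hrho 1 ψ (bump V ψ) q ≤ dt ψ q := by
  unfold FullSub at hnot
  push Not at hnot
  obtain ⟨φ, hφ, q, hq, hmax, hlt⟩ := hnot
  have hact : V q < ψ q := by
    -- Where the bump is inactive, `φ` touches `V` itself. Passing from `V` to the larger bump,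
    -- equal at the point, only raises the Hamiltonian, so the inequality for `V` carries over.
    by_contra! hle
    have hwq := bump_of_le hle
    have hmaxV : IsMaxOn (fun y => V y - φ y) Q q := by
      intro y hy
      have h1 := le_of_isMaxOn hmax hy
      have h2 := le_bump V ψ y
      change V y - φ y ≤ V q - φ q
      linarith
    have h1 := hVsub φ hφ q hq hmaxV
    have h2 := Hrho_le_of_touch one_pos hφ hφ hq rfl (fun y _ => by simp) hV hVM hw hwM
      (fun y _ => by linarith [le_bump V ψ y])
    linarith
  have hwq : bump V ψ q = ψ q := by rw [bump_of_mem hq, max_eq_right hact.le]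
  have hψφ : ∀ y ∈ Q, ψ y - φ y ≤ ψ q - φ q := by
    intro y hy
    have h1 := le_of_isMaxOn hmax hy
    have h2 : ψ y ≤ bump V ψ y := by rw [bump_of_mem hy]; exact le_max_right _ _
    linarith
  obtain ⟨h1, h2⟩ := dx_eq_dt_eq_of_isMaxOn hφ hψ hq hψφ
  have h3 := Hrho_le_of_touch one_pos hφ hψ hq h1.symm hψφ hw hwM hw hwM (fun y _ => by simp)
  exact ⟨q, hq, hact, by linarith⟩

/-- The lower envelope of the Perron solution is a supersolution. -/
theorem fullSub_uscEnv_neg {M : ℝ} {f : ℝ → ℝ} {u : ℝ × ℝ → ℝ} (huM : ∀ q ∈ Q, |u q| ≤ M)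
    (hub : ∀ w, PerronSub M f w → ∀ q ∈ Q, w q ≤ u q) (hsub : FullSub 1 (uscEnv u))
    (hinit : ∀ x, uscEnv u (0, x) ≤ f x) : FullSub 1 (uscEnv fun q => -u q) := by
  have hnM : ∀ q ∈ Q, |(-u q)| ≤ M := fun q hq => by rw [abs_neg]; exact huM q hq
  set v := uscEnv fun q => -u q with hv
  set V := uscEnv u with hV
  have hvusc := upperSemicontinuousOn_uscEnv hnM
  have hVusc := upperSemicontinuousOn_uscEnv huM
  rw [← hv] at hvusc
  rw [← hV] at hVusc
  have hvM : ∀ q ∈ Qbar, |v q| ≤ M := fun q hq => abs_uscEnv_le hnM hq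
  have hVM : ∀ q ∈ Qbar, |V q| ≤ M := fun q hq => abs_uscEnv_le huM hq
  have hvV : ∀ q ∈ Q, -v q ≤ V q := fun q hq => by
    have h1 := le_uscEnv hnM hq
    have h2 := le_uscEnv huM hq
    linarith
  refine fullSub_of_strict fun φ hφ p hp a ha hstrict => ?_
  have hvp := abs_le.1 (hvM p (Q_subset_Qbar hp))
  -- If `v` attains its lower bound `-M` at `p`, then `φ` has a minimum there and both sides vanish.
  -- Otherwise `-v p < M`, which leaves room for a bump that respects the bound `M`.
  rcases hvp.1.eq_or_lt with hvpM | hvpM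
  · obtain ⟨h1, h2⟩ := dx_dt_eq_zero_of_isMinOn hφ hp fun q hq => by
      have h1 := hstrict q hq
      have h2 := mul_nonneg ha.le (gauge_nonneg p q)
      have h3 := (abs_le.1 (hvM q (Q_subset_Qbar hq))).1
      linarith
    rw [Hrho, h1, h2, abs_zero, mul_zero]
  by_contra! hlt
  have hp0 : 0 < p.1 := hp
  -- the bumping functions
  set ψ : ℝ → ℝ × ℝ → ℝ := fun θ q => (φ p - v p + θ) + -φ q with hψ
  have hψc : ∀ θ, ContDiffOn ℝ 2 (ψ θ) Q := fun θ => contDiffOn_const.add hφ.neg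
  have hψle : ∀ θ, ∀ q ∈ Q, ψ θ q ≤ -v q - a * gauge p q + θ := fun θ q hq => by
    have := hstrict q hq
    simp only [hψ]
    linarith
  have hφc : ContinuousAt φ p := hφ.continuousOn.continuousAt (isOpen_Q.mem_nhds hp)
  have hnear : {q : ℝ × ℝ | p.1 / 2 < q.1 ∧ φ p - φ q < (M + v p) / 2} ∈ 𝓝 p :=
    (continuous_fst.continuousAt.eventually (eventually_gt_nhds (by linarith : p.1 / 2 < p.1))).and
      ((hφc.const_sub (φ p)).eventually
        (eventually_lt_nhds (by rw [sub_self]; linarith : φ p - φ p < (M + v p) / 2)))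
  obtain ⟨c, hc, hcs⟩ := exists_gauge_lt_subset hnear
  set θ₀ := min (a * c) ((M + v p) / 2) with hθ₀
  have hθ₀pos : 0 < θ₀ := lt_min (mul_pos ha hc) (by linarith)
  have hactive : ∀ θ, ∀ q ∈ Q, V q < ψ θ q → a * gauge p q < θ := fun θ q hq h => by
    linarith [hψle θ q hq, hvV q hq]
  have hnear' : ∀ θ, θ ≤ θ₀ → ∀ q ∈ Q, V q < ψ θ q →
      p.1 / 2 < q.1 ∧ φ p - φ q < (M + v p) / 2 := fun θ hθ q hq h => by
    refine hcs q (lt_of_mul_lt_mul_left ?_ ha.le)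
    exact (hactive θ q hq h).trans_le (hθ.trans (min_le_left _ _))
  have husc : ∀ θ, θ ≤ θ₀ → UpperSemicontinuousOn (bump V (ψ θ)) Qbar := fun θ hθ =>
    upperSemicontinuousOn_bump hVusc (hψc θ).continuousOn (half_pos hp0) fun q hq hq1 => by
      by_contra! h
      linarith [(hnear' θ hθ q hq h).1]
  have hbd : ∀ θ, θ ≤ θ₀ → ∀ q ∈ Qbar, |bump V (ψ θ) q| ≤ M := by
    intro θ hθ q hq
    have hVq := abs_le.1 (hVM q hq)
    refine abs_le.2 ⟨hVq.1.trans (le_bump _ _ _), ?_⟩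
    by_cases hqQ : q ∈ Q
    · rw [bump_of_mem hqQ]
      refine max_le hVq.2 ?_
      by_contra! h
      have h1 := (hnear' θ hθ q hqQ (hVq.2.trans_lt h)).2
      have h2 := hθ.trans (min_le_right _ _)
      simp only [hψ] at h
      linarith
    · rw [bump, if_neg hqQ]
      exact hVq.2
  -- A bump that were a subsolution would belong to the Perron class and lie below `u`. But `u`
  -- comes within `θ / 2` of `-v p` near `p`, while the bump is higher.
  have hnot : ∀ θ, 0 < θ → θ ≤ θ₀ → ¬ FullSub 1 (bump V (ψ θ)) := by
    intro θ hθ hθ' hfull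
    have hmem : PerronSub M f (bump V (ψ θ)) := ⟨husc θ hθ', hbd θ hθ', hfull, fun x => by
      have : ((0, x) : ℝ × ℝ) ∉ Q := fun h => lt_irrefl _ (mem_Q.1 h)
      rw [bump, if_neg this]
      exact hinit x⟩
    have hfr := frequently_lt_of_lt_uscEnv hnM (Q_subset_Qbar hp)
      (show v p - θ / 2 < uscEnv (fun q => -u q) p by rw [← hv]; linarith)
    have hcont : ∀ᶠ q in 𝓝[Q] p, φ q < φ p + θ / 2 :=
      nhdsWithin_le_nhds (hφc.eventually (eventually_lt_nhds (by linarith)))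
    obtain ⟨q, h1, h2, h3⟩ := (hfr.and_eventually (hcont.and self_mem_nhdsWithin)).exists
    have h4 := hub _ hmem q h3
    rw [bump_of_mem h3] at h4
    have h5 := (le_max_right _ _).trans h4
    simp only [hψ] at h5
    linarith
  -- the violating sequence
  set θ : ℕ → ℝ := fun n => θ₀ * (1 / ((n : ℝ) + 1)) with hθ
  have hθpos : ∀ n, 0 < θ n := fun n => by simp only [hθ]; positivity
  have hθle : ∀ n, θ n ≤ θ₀ := fun n => by
    refine mul_le_of_le_one_right hθ₀pos.le ?_
    rw [div_le_one (by positivity)]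
    have : (0 : ℝ) ≤ n := n.cast_nonneg
    linarith
  have hθlim : Tendsto θ atTop (𝓝 0) := by
    have := tendsto_inv_nat_succ.const_mul θ₀
    rwa [mul_zero] at this
  have hex : ∀ n, ∃ q ∈ Q, V q < ψ (θ n) q ∧ Hrho 1 (ψ (θ n)) (bump V (ψ (θ n))) q ≤
      dt (ψ (θ n)) q := fun n =>
    exists_of_not_fullSub_bump (hVusc.mono Q_subset_Qbar)
      (fun q hq => hVM q (Q_subset_Qbar hq)) hsub (hψc _) ((husc _ (hθle n)).mono Q_subset_Qbar)
      (fun q hq => hbd _ (hθle n) q (Q_subset_Qbar hq)) (hnot _ (hθpos n) (hθle n))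
  choose q hqQ hqact hqH using hex
  have hqlim : Tendsto q atTop (𝓝 p) := by
    have hE : Tendsto (fun n => θ n / a) atTop (𝓝 0) := by simpa using hθlim.div_const a
    refine tendsto_of_gauge hE (Eventually.of_forall fun n => ?_)
    rw [le_div_iff₀ ha, mul_comm]
    exact (hactive _ _ (hqQ n) (hqact n)).le
  -- The violations occur at points tending to `p`. After a change of sign they are inequalities for
  -- `φ` and the negated bumps, which lie below `v`, and stability passes them to the limit,
  -- contradicting `hlt`.
  refine absurd (dt_le_Hrho_of_tendsto (W := v) (M := M) (r := 1) hφ hp (hvusc.mono Q_subset_Qbar)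
    (fun q hq => hvM q (Q_subset_Qbar hq)) (w := fun n q => -bump V (ψ (θ n)) q)
    (fun n => Or.inr ?_) (fun n q hq => ?_) (fun n q hq => ?_) hqQ hqlim ?_ one_pos
    (Eventually.of_forall fun n => ?_)) (not_le.2 hlt)
  · exact continuous_neg.comp_upperSemicontinuousOn_antitone
      ((husc _ (hθle n)).mono Q_subset_Qbar) fun _ _ h => neg_le_neg h
  · rw [abs_neg]
    exact hbd _ (hθle n) q (Q_subset_Qbar hq)
  · linarith [le_bump V (ψ (θ n)) q, hvV q hq]
  · have hval : ∀ n, -bump V (ψ (θ n)) (q n) = φ (q n) - φ p + v p - θ n := fun n => by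
      rw [bump_of_mem (hqQ n), max_eq_right (hqact n).le]
      simp only [hψ]
      ring
    simp only [hval]
    have := (((hφc.tendsto.comp hqlim).sub_const (φ p)).add_const (v p)).sub hθlim
    simpa using this
  · have h1 := hqH n
    have h2 : dt (ψ (θ n)) (q n) = -dt φ (q n) := by
      rw [← dt_neg]
      simp [dt, hψ]
    rw [h2] at h1
    simp only [hψ] at h1
    rw [Hrho_const_add] at h1
    have h3 := Hrho_neg 1 φ (fun y => -bump V (ψ (θ n)) y) (q n)
    simp only [neg_neg] at h3
    simp only [hψ] at h3
    linarith

/-- Truncated quartic functions are subsolutions. -/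
lemma perronSub_lowerBarrier {M K a c : ℝ} {f : ℝ → ℝ} (hM : 0 ≤ M) (hfM : ∀ x, |f x| ≤ M)
    (hK : 1 ≤ K) (hcM : c ≤ M) (hcf : ∀ x, c - K * (x - a) ^ 4 ≤ f x) :
    PerronSub M f fun q => max (c - K * (q.2 - a) ^ 4 - barrierRate K M * q.1) (-M) := by
  set C := barrierRate K M with hC
  have hC1 := one_le_barrierRate (K := K) (by linarith) hM
  rw [← hC] at hC1
  set w : ℝ × ℝ → ℝ := fun q => max (c - K * (q.2 - a) ^ 4 - C * q.1) (-M) with hw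
  have hwc : Continuous w := by rw [hw]; fun_prop
  have hwM : ∀ q ∈ Qbar, |w q| ≤ M := by
    intro q hq
    have h1 : 0 ≤ K * (q.2 - a) ^ 4 := by positivity
    have h2 : 0 ≤ C * q.1 := mul_nonneg (by linarith) hq
    exact abs_le.2 ⟨le_max_right _ _, max_le (by linarith) (by linarith)⟩
  refine ⟨hwc.upperSemicontinuous.upperSemicontinuousOn _, hwM, fun φ hφ q hq hmax => ?_,
    fun x => max_le (by simpa using hcf x) (abs_le.1 (hfM x)).1⟩
  have hq0 : 0 < q.1 := hq
  -- On the truncated part `w` is at its global minimum, so `φ` has a minimum there and both sides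
  -- vanish. On the active part `φ` touches the quartic `b`, whose speed `-C` lies below any
  -- possible value of its Hamiltonian.
  rcases le_or_gt (c - K * (q.2 - a) ^ 4 - C * q.1) (-M) with hle | hgt
  · have hwq : w q = -M := max_eq_right hle
    obtain ⟨h1, h2⟩ := dx_dt_eq_zero_of_isMinOn hφ hq fun y hy => by
      have h1 := le_of_isMaxOn hmax hy
      have h2 : -M ≤ w y := le_max_right _ _
      linarith
    rw [Hrho, h1, h2, abs_zero, mul_zero]
  · have hwq : w q = c - K * (q.2 - a) ^ 4 - C * q.1 := max_eq_left hgt.le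
    set g : ℝ → ℝ := fun t => C * t - c with hg
    have hgc : ContDiff ℝ 2 g := by rw [hg]; fun_prop
    set b : ℝ × ℝ → ℝ := fun y => -quarticTest K a g y with hb
    have hbv : ∀ y, b y = c - K * (y.2 - a) ^ 4 - C * y.1 := fun y => by
      simp only [hb, quarticTest, hg]; ring
    have hbc : ContDiffOn ℝ 2 b Q := (contDiff_quarticTest K a hgc).neg.contDiffOn
    have hbφ : ∀ y ∈ Q, b y - φ y ≤ b q - φ q := fun y hy => by
      have h1 := le_of_isMaxOn hmax hy
      have h2 : b y ≤ w y := by rw [hbv]; exact le_max_left _ _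
      have h3 : b q = w q := by rw [hbv, hwq]
      linarith
    obtain ⟨h1, h2⟩ := dx_eq_dt_eq_of_isMaxOn hφ hbc hq hbφ
    have hwusc : UpperSemicontinuousOn w Q := hwc.upperSemicontinuous.upperSemicontinuousOn _
    have hwMQ : ∀ y ∈ Q, |w y| ≤ M := fun y hy => hwM y (Q_subset_Qbar hy)
    have h3 := Hrho_le_of_touch one_pos hφ hbc hq h1.symm hbφ hwusc hwMQ hwusc hwMQ
      (fun y _ => by simp)
    have h4 := Hrho_neg 1 (quarticTest K a g) (fun y => -w y) q
    simp only [neg_neg] at h4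
    have hdt : dt b q = -C := by
      have hd : deriv g q.1 = C := by
        have : HasDerivAt g C q.1 := by
          simpa [hg] using ((hasDerivAt_id q.1).const_mul C).sub_const c
        exact this.deriv
      rw [hb, dt_neg, dt_quarticTest, hd]
    have hR : |q.2 - a| ≤ 2 * M + 1 := by
      by_contra! hbig
      have e1 : (2 * M + 1) ^ 4 ≤ (q.2 - a) ^ 4 := by
        rw [← Even.pow_abs (by decide) (q.2 - a)]
        gcongr
      have e2 : 2 * M + 1 ≤ (2 * M + 1) ^ 4 := le_self_pow₀ (by linarith) (by norm_num)
      have e3 : (q.2 - a) ^ 4 ≤ K * (q.2 - a) ^ 4 := le_mul_of_one_le_left (by positivity) hK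
      have e4 : 0 ≤ C * q.1 := by positivity
      linarith
    have hI := Irho_quarticTest_le (K := K) (a := a) (by linarith) (g := g) one_pos le_rfl hR
      (w := fun y => -w (q.1, y)) (M := M) (fun y => by rw [abs_neg]; exact hwMQ _ hq)
    have hS := abs_slope_quartic_le (K := K) (by linarith) hR
    have hT := tailMass_nonneg 1
    have hfin := mul_le_mul hI hS (abs_nonneg _) (by positivity)
    have hH : Hrho 1 (quarticTest K a g) (fun y => -w y) q ≤ C - 1 := by
      rw [Hrho, dx_quarticTest]
      refine hfin.trans (le_of_eq ?_)
      rw [hC, barrierRate]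
      ring
    rw [h2, hdt]
    change Hrho 1 b w q = -Hrho 1 (quarticTest K a g) (fun y => -w y) q at h4
    linarith

/-- Existence of a solution for the strongest notion. -/
theorem exists_full_solution {f : ℝ → ℝ} (hf : UniformContinuous f) {M : ℝ}
    (hfM : ∀ x, |f x| ≤ M) : ∃ u : ℝ × ℝ → ℝ, (∀ q ∈ Q, |u q| ≤ M) ∧ FullSub 1 (uscEnv u) ∧
      FullSub 1 (uscEnv fun q => -u q) ∧ HasInitialDatum u f := by
  have hM : 0 ≤ M := (abs_nonneg _).trans (hfM 0)
  set F : Set (ℝ × ℝ → ℝ) := {w | PerronSub M f w} with hF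
  set u : ℝ × ℝ → ℝ := fun q => sSup ((fun w : ℝ × ℝ → ℝ => w q) '' F) with hu
  obtain ⟨K₁, C₁, hK₁, -, -, hlow₁, -⟩ := exists_initial_rate hf hfM one_pos
  have hne : F.Nonempty := ⟨_, perronSub_lowerBarrier (a := 0) (c := f 0 - 1) hM hfM hK₁
    (by linarith [(abs_le.1 (hfM 0)).2]) (hlow₁ 0)⟩
  have hbdd : ∀ q ∈ Q, BddAbove ((fun w : ℝ × ℝ → ℝ => w q) '' F) := by
    rintro q hq
    refine ⟨M, ?_⟩
    rintro _ ⟨w, hw, rfl⟩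
    exact (abs_le.1 (hw.bound q (Q_subset_Qbar hq))).2
  have hub : ∀ w, PerronSub M f w → ∀ q ∈ Q, w q ≤ u q := fun w hw q hq =>
    le_csSup (hbdd q hq) ⟨w, hw, rfl⟩
  have hle : ∀ q ∈ Q, ∀ c, (∀ w, PerronSub M f w → w q ≤ c) → u q ≤ c := fun q _ c h =>
    csSup_le (hne.image _) (by rintro _ ⟨w, hw, rfl⟩; exact h w hw)
  have hlub : ∀ q ∈ Q, ∀ c < u q, ∃ w ∈ F, c < w q := fun q _ c hc => by
    obtain ⟨_, ⟨w, hw, rfl⟩, h⟩ := exists_lt_of_lt_csSup (hne.image _) hc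
    exact ⟨w, hw, h⟩
  have huM : ∀ q ∈ Q, |u q| ≤ M := by
    intro q hq
    refine abs_le.2 ⟨?_, hle q hq M fun w hw => (abs_le.1 (hw.bound q (Q_subset_Qbar hq))).2⟩
    obtain ⟨w, hw⟩ := hne
    exact (abs_le.1 (hw.bound q (Q_subset_Qbar hq))).1.trans (hub w hw q hq)
  have hnM : ∀ q ∈ Q, |(-u q)| ≤ M := fun q hq => by rw [abs_neg]; exact huM q hq
  have hsub : FullSub 1 (uscEnv u) := fullSub_uscEnv_of_sup one_pos (F := F)
    (fun w hw => ⟨hw.usc.mono Q_subset_Qbar, fun q hq => hw.bound q (Q_subset_Qbar hq), hw.sub⟩)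
    huM hub hlub
  have h0 : ∀ x, ((0, x) : ℝ × ℝ) ∈ Qbar := fun x => mem_Qbar.2 le_rfl
  -- The rate `C` is uniform over the Perron class, so the upper bound survives the supremum. From
  -- below, the truncated quartics belong to the class themselves.
  have hinit : ∀ x, uscEnv u (0, x) ≤ f x := by
    intro x
    refine le_of_forall_pos_le_add fun ε hε => ?_
    obtain ⟨K, C, -, -, -, -, hI⟩ := exists_initial_rate hf hfM (half_pos hε)
    have hc : Continuous fun q : ℝ × ℝ => f q.2 + ε / 2 + C * q.1 := by
      have := hf.continuous
      fun_prop
    have hev : ∀ᶠ q in 𝓝[Q] ((0, x) : ℝ × ℝ), f q.2 + ε / 2 + C * q.1 < f x + ε :=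
      nhdsWithin_le_nhds (hc.continuousAt.eventually (eventually_lt_nhds (by
        simp only [mul_zero]; linarith)))
    refine uscEnv_le_of_eventually huM (h0 x) ?_
    filter_upwards [hev, self_mem_nhdsWithin] with q h1 h2
    exact (hle q h2 _ fun w hw => hI 1 one_pos w hw.weakSub hw.init q (Q_subset_Qbar h2)).trans
      h1.le
  have hinit' : ∀ x, uscEnv (fun q => -u q) (0, x) ≤ -f x := by
    intro x
    refine le_of_forall_pos_le_add fun ε hε => ?_
    obtain ⟨K, C, hK, -, -, hlow, -⟩ := exists_initial_rate hf hfM (half_pos hε)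
    have hP := perronSub_lowerBarrier (a := x) (c := f x - ε / 2) hM hfM hK
      (by linarith [(abs_le.1 (hfM x)).2]) (hlow x)
    have hc : Continuous fun q : ℝ × ℝ =>
      f x - ε / 2 - K * (q.2 - x) ^ 4 - barrierRate K M * q.1 := by fun_prop
    have hev : ∀ᶠ q in 𝓝[Q] ((0, x) : ℝ × ℝ),
        f x - ε < f x - ε / 2 - K * (q.2 - x) ^ 4 - barrierRate K M * q.1 :=
      nhdsWithin_le_nhds (hc.continuousAt.eventually (eventually_gt_nhds (by
        simp; linarith)))
    refine uscEnv_le_of_eventually hnM (h0 x) ?_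
    filter_upwards [hev, self_mem_nhdsWithin] with q h1 h2
    have := (le_max_left _ _).trans (hub _ hP q h2)
    linarith
  refine ⟨u, huM, hsub, fullSub_uscEnv_neg huM hub hsub hinit, fun x => ?_⟩
  have hge : -uscEnv (fun q => -u q) (0, x) ≤ uscEnv u (0, x) := by
    by_contra! h
    have e1 := eventually_lt_of_uscEnv_lt hnM (c := -uscEnv u (0, x)) (p := (0, x)) (by linarith)
    obtain ⟨c, hc1, hc2⟩ := exists_between h
    have e2 := eventually_lt_of_uscEnv_lt hnM (c := -c) (p := (0, x)) (by linarith)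
    have e3 := eventually_lt_of_uscEnv_lt huM hc1
    have := neBot_nhdsWithin_Q (h0 x)
    obtain ⟨q, h2, h3⟩ := (e2.and e3).exists
    linarith
  rw [lscEnv_eq_neg]
  constructor <;> linarith [hinit x, hinit' x]

/-! ### Solutions -/

lemma uscEnv_congr {u v : ℝ × ℝ → ℝ} (h : EqOn u v Q) : uscEnv u = uscEnv v := by
  funext p
  exact limsup_congr (eventually_of_mem self_mem_nhdsWithin h)

lemma lscEnv_congr {u v : ℝ × ℝ → ℝ} (h : EqOn u v Q) : lscEnv u = lscEnv v := by
  funext p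
  exact liminf_congr (eventually_of_mem self_mem_nhdsWithin h)

lemma IsIMRSolution.congr {σ : ℝ} {u v : ℝ × ℝ → ℝ} (hu : IsIMRSolution σ u) (h : EqOn u v Q) :
    IsIMRSolution σ v := by
  obtain ⟨⟨M, hM⟩, h2, h3⟩ := hu
  rw [uscEnv_congr h] at h2
  rw [lscEnv_congr h] at h3
  exact ⟨⟨M, fun p hp => h hp ▸ hM p hp⟩, h2, h3⟩

lemma IsIMRSolution.isSolution {σ : ℝ} {u : ℝ × ℝ → ℝ} (h : IsIMRSolution σ u) :
    IsSolution σ u := by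
  obtain ⟨hb, ⟨h1, h2, h3⟩, ⟨h4, h5, h6⟩⟩ := h
  refine ⟨hb, ⟨h1, h2, fun φ hφ p hp hm => ⟨fun _ => h3 φ hφ p hp hm,
    FullSub.quarticSub h3 φ hφ p hp hm⟩⟩, ⟨h4, h5, fun ψ hψ p hp hm =>
    ⟨fun _ => h6 ψ hψ p hp hm, fun hq => ?_⟩⟩⟩
  simpa [Hrho, dx_eq_zero_of_isQuarticAt hp hq] using h6 ψ hψ p hp hm

lemma isMinOn_of_isMaxOn_neg {u φ : ℝ × ℝ → ℝ} {p : ℝ × ℝ}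
    (hm : IsMaxOn (fun q => u q - φ q) Q p) : IsMinOn (fun q => -u q - -φ q) Q p := by
  intro q hq
  have := le_of_isMaxOn hm hq
  change -u p - -φ p ≤ -u q - -φ q
  linarith

lemma isMaxOn_of_isMinOn_neg {u φ : ℝ × ℝ → ℝ} {p : ℝ × ℝ}
    (hm : IsMinOn (fun q => -u q - φ q) Q p) : IsMaxOn (fun q => u q - -φ q) Q p := by
  intro q hq
  have : -u p - φ p ≤ -u q - φ q := hm hq
  change u q - -φ q ≤ u p - -φ p
  linarith

lemma slopeSub_of_isSupersolution {ρ : ℝ} {u : ℝ × ℝ → ℝ}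
    (h : IsSupersolution ρ fun q => -u q) : SlopeSub ρ u := by
  intro φ hφ p hp hm hd
  have h1 := (h.2.2 (fun q => -φ q) hφ.neg p hp (isMinOn_of_isMaxOn_neg hm)).1
    (by rw [dx_neg]; exact neg_ne_zero.2 hd)
  rw [Hrho_neg, dt_neg] at h1
  linarith

lemma quarticSub_of_isSupersolution {ρ : ℝ} {u : ℝ × ℝ → ℝ}
    (h : IsSupersolution ρ fun q => -u q) : QuarticSub u := by
  rintro φ hφ p hp hm ⟨c, g, hg⟩
  have h1 := (h.2.2 (fun q => -φ q) hφ.neg p hp (isMinOn_of_isMaxOn_neg hm)).2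
    ⟨-c, fun t => -g t, fun q hq => by simp only [hg q hq]; ring⟩
  rw [dt_neg] at h1
  linarith

/-- Both envelopes of a restricted solution give restricted subsolutions up to time zero. -/
lemma IsSolution.weakSub {ρ : ℝ} {u : ℝ × ℝ → ℝ} (h : IsSolution ρ u) {M : ℝ}
    (hM : ∀ q ∈ Q, |u q| ≤ M) :
    WeakSub ρ M (uscEnv u) ∧ WeakSub ρ M (uscEnv fun q => -u q) := by
  obtain ⟨-, hsub, hsup⟩ := h
  have hnM : ∀ q ∈ Q, |(-u q)| ≤ M := fun q hq => by rw [abs_neg]; exact hM q hq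
  have e : lscEnv u = fun q => -uscEnv (fun q => -u q) q := funext (lscEnv_eq_neg u)
  rw [e] at hsup
  exact ⟨⟨upperSemicontinuousOn_uscEnv hM, fun p hp => abs_uscEnv_le hM hp,
      fun φ hφ p hp hm => (hsub.2.2 φ hφ p hp hm).1,
      fun φ hφ p hp hm => (hsub.2.2 φ hφ p hp hm).2⟩,
    ⟨upperSemicontinuousOn_uscEnv hnM, fun p hp => abs_uscEnv_le hnM hp,
      slopeSub_of_isSupersolution hsup, quarticSub_of_isSupersolution hsup⟩⟩

lemma IsSolution.le_of_initialDatum {ρ σ : ℝ} (hρ : 0 < ρ) (hσ : 0 < σ) {u v : ℝ × ℝ → ℝ}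
    (hu : IsSolution ρ u) (hv : IsSolution σ v) {f : ℝ → ℝ} (hf : UniformContinuous f)
    (hb : ∃ M : ℝ, ∀ x, |f x| ≤ M) (hu0 : HasInitialDatum u f) (hv0 : HasInitialDatum v f)
    {p : ℝ × ℝ} (hp : p ∈ Q) : u p ≤ v p := by
  obtain ⟨M₁, hM₁⟩ := hu.1
  obtain ⟨M₂, hM₂⟩ := hv.1
  obtain ⟨M₃, hM₃⟩ := hb
  set M := max M₁ (max M₂ M₃)
  have hMu : ∀ q ∈ Q, |u q| ≤ M := fun q hq => (hM₁ q hq).trans (le_max_left _ _)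
  have hMv : ∀ q ∈ Q, |v q| ≤ M := fun q hq =>
    (hM₂ q hq).trans ((le_max_left _ _).trans (le_max_right _ _))
  have hMn : ∀ q ∈ Q, |(-v q)| ≤ M := fun q hq => by rw [abs_neg]; exact hMv q hq
  have key := (hu.weakSub hMu).1.add_nonpos (hv.weakSub hMv).2 hρ hσ hf
    (fun x => (hM₃ x).trans ((le_max_right _ _).trans (le_max_right _ _)))
    (fun x => (hu0 x).1.le) (fun x => by
      have := (hv0 x).2
      rw [lscEnv_eq_neg] at this
      linarith) (Q_subset_Qbar hp)
  linarith [le_uscEnv hMu hp, le_uscEnv hMn hp]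

theorem IsSolution.eqOn_of_initialDatum {ρ σ : ℝ} (hρ : 0 < ρ) (hσ : 0 < σ) {u v : ℝ × ℝ → ℝ}
    (hu : IsSolution ρ u) (hv : IsSolution σ v) {f : ℝ → ℝ} (hf : UniformContinuous f)
    (hb : ∃ M : ℝ, ∀ x, |f x| ≤ M) (hu0 : HasInitialDatum u f) (hv0 : HasInitialDatum v f) :
    EqOn u v Q := fun _ hp =>
  le_antisymm (hu.le_of_initialDatum hρ hσ hv hf hb hu0 hv0 hp)
    (hv.le_of_initialDatum hσ hρ hu hf hb hv0 hu0 hp)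

lemma isIMRSolution_of_fullSub {u : ℝ × ℝ → ℝ} {M : ℝ} (hM : ∀ q ∈ Q, |u q| ≤ M)
    (h1 : FullSub 1 (uscEnv u)) (h2 : FullSub 1 (uscEnv fun q => -u q)) {σ : ℝ} (hσ : 0 < σ) :
    IsIMRSolution σ u := by
  have hnM : ∀ q ∈ Q, |(-u q)| ≤ M := fun q hq => by rw [abs_neg]; exact hM q hq
  have u1 := (upperSemicontinuousOn_uscEnv hM).mono Q_subset_Qbar
  have u2 := (upperSemicontinuousOn_uscEnv hnM).mono Q_subset_Qbar
  have b1 : BoundedOnQ (uscEnv u) := ⟨M, fun p hp => abs_uscEnv_le hM (Q_subset_Qbar hp)⟩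
  have b2 : BoundedOnQ (uscEnv fun q => -u q) :=
    ⟨M, fun p hp => abs_uscEnv_le hnM (Q_subset_Qbar hp)⟩
  have e : lscEnv u = fun q => -uscEnv (fun q => -u q) q := funext (lscEnv_eq_neg u)
  refine ⟨⟨M, hM⟩, ⟨u1, b1, h1.radius u1 b1 hσ one_pos⟩, ?_⟩
  rw [e]
  refine ⟨continuous_neg.comp_upperSemicontinuousOn_antitone u2 fun _ _ h => neg_le_neg h,
    ⟨M, fun p hp => by rw [abs_neg]; exact abs_uscEnv_le hnM (Q_subset_Qbar hp)⟩,
    fun ψ hψ p hp hm => ?_⟩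
  have h3 := h2.radius u2 b2 hσ one_pos (fun q => -ψ q) hψ.neg p hp (isMaxOn_of_isMinOn_neg hm)
  have h4 := Hrho_neg σ ψ (fun q => -uscEnv (fun q => -u q) q) p
  simp only [neg_neg] at h4
  rw [dt_neg] at h3
  change Hrho σ (fun q => -ψ q) (uscEnv fun q => -u q) p = _ at h4
  linarith

end HJ

theorem corollary3p11 (u₀ : ℝ → ℝ) (hu₀ : UniformContinuous u₀) (hb : ∃ M : ℝ, ∀ x, |u₀ x| ≤ M) :
    -- the two notions coincide, whatever the radii used in the two definitions
    (∀ ρ > 0, ∀ σ > 0, ∀ u : ℝ × ℝ → ℝ,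
      (HJ.IsSolution ρ u ∧ HJ.HasInitialDatum u u₀) ↔
        (HJ.IsIMRSolution σ u ∧ HJ.HasInitialDatum u u₀)) ∧
    -- existence and uniqueness on `Q` of the viscosity solution with initial datum `u₀`
    (∃ u : ℝ × ℝ → ℝ, (∀ ρ > 0, HJ.IsSolution ρ u) ∧ HJ.HasInitialDatum u u₀ ∧
      ∀ ρ > 0, ∀ v : ℝ × ℝ → ℝ,
        HJ.IsSolution ρ v → HJ.HasInitialDatum v u₀ → EqOn v u HJ.Q) := by
  obtain ⟨M, hM⟩ := id hb
  obtain ⟨u, huM, hsub, hsup, hu0⟩ := HJ.exists_full_solution hu₀ hM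
  have hIMR : ∀ σ > 0, HJ.IsIMRSolution σ u := fun σ hσ =>
    HJ.isIMRSolution_of_fullSub huM hsub hsup hσ
  have huniq : ∀ ρ > 0, ∀ v : ℝ × ℝ → ℝ, HJ.IsSolution ρ v → HJ.HasInitialDatum v u₀ →
      EqOn v u HJ.Q := fun ρ hρ v hv hv0 =>
    hv.eqOn_of_initialDatum hρ one_pos (hIMR 1 one_pos).isSolution hu₀ hb hv0 hu0
  refine ⟨fun ρ hρ σ hσ v => ⟨fun ⟨hv, hv0⟩ => ⟨?_, hv0⟩, fun ⟨hv, hv0⟩ => ⟨?_, hv0⟩⟩,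
    u, fun ρ hρ => (hIMR ρ hρ).isSolution, hu0, huniq⟩
  -- Stronger regularity of an arbitrary restricted solution is not proved directly: uniqueness
  -- identifies it on `Q` with the Perron solution.
  · exact (hIMR σ hσ).congr (huniq ρ hρ v hv hv0).symm
  · exact ((hIMR ρ hρ).congr (huniq σ hσ v hv.isSolution hv0).symm).isSolution
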